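/- Let $n\ge 1$ be an integer and let $\alpha\in\mathbb{C}$ satisfy $2k+n-\alpha\neq 0$ and $2k+n+\alpha\neq 0$ for all integers $k\ge 0$. For a compact interval $[a,b]$ let $\mathcal{T}_n([a,b])$ be the space of functions $g\in C^{n-2}([a,b];\mathbb{C})$ with $g^{(j)}(a)=g^{(j)}(b)=0$ for $0\le j\le n-2$ and with (weak) derivative $g^{(n-1)}\in L^\infty([a,b])$; for $n=1$ this is $L^\infty([a,b])$. Put $\mathcal{X}=\mathcal{T}_n([-\tfrac{\pi}{2},\tfrac{\pi}{2}])$ and $\mathcal{Y}=\mathcal{T}_n([\tfrac{\pi}{2},\tfrac{3\pi}{2}])$. For $g\in\mathcal{X}$ or $g\in\mathcal{Y}$ let $$\langle\Psi_\alpha,g\rangle=\sum_{k\ge 0}(-1)^k\binom{k+n-1}{k}\int\left(\frac{e^{i(2k+n-\alpha)\theta}}{2k+n-\alpha}+\frac{e^{-i(2k+n+\alpha)\theta}}{2k+n+\alpha}\right)g(\theta)\,d\theta ,\qquad \langle 1,g\rangle=\int g(\theta)\,d\theta ,$$ the integrals being over $[-\tfrac{\pi}{2},\tfrac{\pi}{2}]$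 for $g\in\mathcal{X}$ and over $[\tfrac{\pi}{2},\tfrac{3\pi}{2}]$ for $g\in\mathcal{Y}$. Then the series converges absolutely for every such $g$, and $$\langle\Psi_\alpha,g\rangle=C_\alpha\,\langle 1,g\rangle\quad(g\in\mathcal{X}),\qquad \langle\Psi_\alpha,g\rangle=(-1)^n e^{-i\alpha\pi}\,C_\alpha\,\langle 1,g\rangle\quad(g\in\mathcal{Y}),$$ where $$C_\alpha=\frac{\Gamma\left(\frac{n+\alpha}{2}\right)\Gamma\left(\frac{n-\alpha}{2}\right)}{2\,(n-1)!}.$$ -/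

import Mathlib

/-- `h` is a derivative of order `m` of `g` on the interval `[a, b]`, in the sense of weak
derivatives: for `m = 0` it agrees with `g` almost everywhere, and for `m = j + 1` the classical
derivative `g⁽ʲ⁾` is the indefinite integral of `h` on `[a, b]` (so that `g⁽ʲ⁾` is absolutely
continuous with almost everywhere derivative `h`, when `h` is integrable). -/
def IsDerivOfOrder (a b : ℝ) (g h : ℝ → ℂ) : ℕ → Prop
  | 0 => g =ᵐ[MeasureTheory.volume.restrict (Set.Icc a b)] h
  | j + 1 => ∀ x ∈ Set.Icc a b,
      iteratedDerivWithin j g (Set.Icc a b) x =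
        iteratedDerivWithin j g (Set.Icc a b) a + ∫ t in a..x, h t

/-- The test functions on `[a, b]`: complex functions of class `C^{n-2}` on `[a, b]` whose
derivatives of order `j` with `0 ≤ j ≤ n - 2` vanish at both end points, and whose derivative of
order `n - 1` is in `L^∞(a, b)`. For `n = 1` only the last condition is there, and the space
is `L^∞(a, b)`. Only the values on `[a, b]` matter. -/
structure IsTestFunction (n : ℕ) (a b : ℝ) (g : ℝ → ℂ) : Prop where
  contDiffOn : ∀ j : ℕ, j + 2 ≤ n → ContDiffOn ℝ (j : ℕ∞) g (Set.Icc a b)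
  left_eq_zero : ∀ j : ℕ, j + 2 ≤ n → iteratedDerivWithin j g (Set.Icc a b) a = 0
  right_eq_zero : ∀ j : ℕ, j + 2 ≤ n → iteratedDerivWithin j g (Set.Icc a b) b = 0
  bounded_deriv : ∃ h : ℝ → ℂ,
    MeasureTheory.MemLp h ⊤ (MeasureTheory.volume.restrict (Set.Icc a b)) ∧
      IsDerivOfOrder a b g h (n - 1)

/-- The space of test functions on `[-π/2, π/2]`. -/
def spaceX (n : ℕ) : Set (ℝ → ℂ) :=
  {g | IsTestFunction n (-(Real.pi / 2)) (Real.pi / 2) g}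

/-- The space of test functions on `[π/2, 3π/2]`. -/
def spaceY (n : ℕ) : Set (ℝ → ℂ) :=
  {g | IsTestFunction n (Real.pi / 2) (3 * Real.pi / 2) g}

/-- The `k`-th term of the series `Ψ_α`, a function of `θ`. -/
noncomputable def psiTerm (n : ℕ) (α : ℂ) (k : ℕ) (θ : ℝ) : ℂ :=
  (-1) ^ k * (Nat.choose (k + n - 1) k : ℂ) *
    (Complex.exp (Complex.I * (2 * k + n - α) * θ) / (2 * k + n - α) +
      Complex.exp (-(Complex.I * (2 * k + n + α) * θ)) / (2 * k + n + α))

/-- The pairing `⟨u, g⟩ = ∫ u g` of two functions over `[a, b]`. -/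
noncomputable def pairing (a b : ℝ) (u g : ℝ → ℂ) : ℂ :=
  ∫ θ in a..b, u θ * g θ

/-- The pairing `⟨Ψ_α, g⟩` over `[a, b]`: the series `Ψ_α` is applied to `g` term by term. -/
noncomputable def psiPairing (n : ℕ) (α : ℂ) (a b : ℝ) (g : ℝ → ℂ) : ℂ :=
  ∑' k : ℕ, pairing a b (psiTerm n α k) g

/-- The constant `C_α = Γ((n+α)/2) Γ((n-α)/2) / (2 (n-1)!)`. -/
noncomputable def constC (n : ℕ) (α : ℂ) : ℂ :=
  Complex.Gamma ((n + α) / 2) * Complex.Gamma ((n - α) / 2) / (2 * (Nat.factorial (n - 1) : ℂ))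

/-!
Write `n = m + 1`. On `(-π/2, π/2)` the series `Ψ_α` is a constant in the sense of Abel summation:
by the binomial series, the derivative in `θ` of its Abel mean `∑ x^k psiTerm n α k θ` is
`i e^{-iαθ} ((e^{-iθ} + x e^{iθ})^{-n} - (e^{iθ} + x e^{-iθ})^{-n})` (`hasSum_psiTermDeriv`), and for
`x → 1` the two terms cancel. The derivative is bounded by a multiple of `(cos θ)^{-n}` uniformly in
`x`, hence the Abel mean differs from its value at `θ = 0` by at most a multiple of
`(cos θ)^{-(n-1) - 1/2}` (`norm_integral_abelKernel_le`). A test function is an `(n-1)`-fold primitive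
of a bounded function, so it vanishes like `(cos θ)^{n-1}` at the end points
(`IsIterPrimitive.exists_bound`), and dominated convergence shows that only the limit of the Abel
means at `θ = 0` matters (`tendsto_integral_integral_abelKernel_mul`).

The pairings themselves converge absolutely: `n - 1` integrations by parts turn the `k`-th one into
`O(1 / k)` times a Fourier coefficient of a bounded function, and these are square summable by
Bessel's inequality on an interval of length `π` (`summable_pairing_psiTerm`). So the Abel limit of
the pairings is their sum.

The value at `θ = 0` is the sum for `s = n - α` and `s = n + α` of the Abel means
`∑ (-1)^k (k+m choose m) x^k / (2k + s)`. When both numbers have positive real part, the limit is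
`∫₀¹ t^{s-1} (1 + t²)^{-n} dt`, one half of a beta integral (`halfBeta_eq_integral`). The other `α`
are reduced to these by the exact counterpart for Abel means of the functional equation of `Γ`
(`HasAbelLimit.of_succ`), which raises `n` by one and `s` by two, so that no analytic continuation
is needed.

The interval `[π/2, 3π/2]` is a translate by `π`, under which every term of the series is multiplied
by `(-1)^n e^{-iαπ}` (`psiTerm_add_pi`).
-/

namespace PsiSeries

open MeasureTheory Filter Topology Complex Set
open scoped Real Interval

/-! ### The binomial series -/

/-- The Taylor coefficients of `(1 + z) ^ (-(m + 1))` at the origin. -/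
noncomputable def binomCoeff (m k : ℕ) : ℂ := (-1) ^ k * ((k + m).choose m : ℂ)

lemma norm_binomCoeff (m k : ℕ) : ‖binomCoeff m k‖ = ((k + m).choose m : ℝ) := by
  simp [binomCoeff]

lemma hasSum_binomCoeff (m : ℕ) {z : ℂ} (hz : ‖z‖ < 1) :
    HasSum (fun k => binomCoeff m k * z ^ k) (((1 + z) ^ (m + 1))⁻¹) := by
  have h := hasSum_choose_mul_geometric_of_norm_lt_one m (r := -z) (by simpa using hz)
  rw [sub_neg_eq_add, one_div] at h
  refine h.congr_fun fun k => ?_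
  rw [binomCoeff, neg_pow z]
  ring

lemma summable_norm_binomCoeff (m : ℕ) {x : ℝ} (h0 : 0 ≤ x) (h1 : x < 1) :
    Summable fun k => ‖binomCoeff m k‖ * x ^ k := by
  simp_rw [norm_binomCoeff]
  exact summable_choose_mul_geometric_of_norm_lt_one m (by rwa [Real.norm_of_nonneg h0])

lemma binomCoeff_zero (m : ℕ) : binomCoeff m 0 = 1 := by simp [binomCoeff]

/-- Pascal's rule, that is, `(1 + z) ^ (-(m + 1)) = (1 + z) * (1 + z) ^ (-(m + 2))`. -/
lemma binomCoeff_succ_eq_add (m k : ℕ) :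
    binomCoeff m (k + 1) = binomCoeff (m + 1) (k + 1) + binomCoeff (m + 1) k := by
  have h : ((k + 1 + (m + 1)).choose (m + 1) : ℂ)
      = (k + 1 + m).choose m + (k + (m + 1)).choose (m + 1) := by
    rw [show k + 1 + (m + 1) = (k + 1 + m) + 1 by ring, Nat.choose_succ_succ,
      show k + (m + 1) = k + 1 + m by ring]
    push_cast
    ring
  simp only [binomCoeff, h, pow_succ]
  ring

/-- The coefficientwise form of the derivative of `(1 + z) ^ (-(m + 1))`. -/
lemma succ_mul_binomCoeff_succ (m k : ℕ) :
    ((k : ℂ) + 1) * binomCoeff m (k + 1) = -((m + 1) * binomCoeff (m + 1) k) := by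
  have h : ((k + 1 + m).choose (m + 1) * (m + 1) : ℂ) = (k + 1 + m).choose m * (k + 1) := by
    have := Nat.choose_succ_right_eq (k + 1 + m) m
    rw [show k + 1 + m - m = k + 1 by omega] at this
    exact_mod_cast this
  rw [binomCoeff, binomCoeff, show k + (m + 1) = k + 1 + m by ring, pow_succ]
  linear_combination (-1 : ℂ) ^ k * h

lemma tendsto_norm_two_mul_add_atTop (s : ℂ) :
    Tendsto (fun k : ℕ => ‖(2 * k + s : ℂ)‖) atTop atTop := by
  refine tendsto_atTop_mono (f := fun k : ℕ => (k : ℝ) - ‖s‖) (fun k => ?_) ?_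
  · have h : ‖(2 * k : ℂ)‖ ≤ ‖(2 * k + s : ℂ)‖ + ‖s‖ := by
      simpa using norm_sub_le (2 * k + s : ℂ) s
    have h2 : ‖(2 * k : ℂ)‖ = 2 * k := by simp
    have : (0 : ℝ) ≤ k := k.cast_nonneg
    linarith
  · exact tendsto_atTop_add_const_right _ _ tendsto_natCast_atTop_atTop

lemma exists_norm_inv_two_mul_add_le (s : ℂ) :
    ∃ C : ℝ, 0 ≤ C ∧ ∀ k : ℕ, ‖(2 * k + s : ℂ)⁻¹‖ ≤ C := by
  have h : Tendsto (fun k : ℕ => ‖(2 * k + s : ℂ)⁻¹‖) atTop (𝓝 0) := by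
    simpa only [norm_inv] using! (tendsto_norm_two_mul_add_atTop s).inv_tendsto_atTop
  obtain ⟨C, hC⟩ := h.bddAbove_range
  exact ⟨C, (norm_nonneg _).trans (hC ⟨0, rfl⟩), fun k => hC ⟨k, rfl⟩⟩

/-! ### Abel means of the partial fraction series -/

/-- The power series `∑ (-1)^k (k+m choose m) x^k / (2k + s)`, which is the Mellin transform
`∫₀¹ t^(s-1) (1 + x t²)^(-(m+1)) dt` where the latter converges. -/
noncomputable def abelSum (m : ℕ) (s : ℂ) (x : ℝ) : ℂ :=
  ∑' k : ℕ, binomCoeff m k * (x : ℂ) ^ k * (2 * k + s)⁻¹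

lemma summable_abelSum (m : ℕ) (s : ℂ) {x : ℝ} (h0 : 0 ≤ x) (h1 : x < 1) :
    Summable fun k : ℕ => binomCoeff m k * (x : ℂ) ^ k * (2 * k + s)⁻¹ := by
  obtain ⟨C, hC0, hC⟩ := exists_norm_inv_two_mul_add_le s
  refine Summable.of_norm_bounded ((summable_norm_binomCoeff m h0 h1).mul_right C) fun k => ?_
  rw [norm_mul, norm_mul, norm_pow, norm_real, Real.norm_of_nonneg h0]
  gcongr
  exact hC k

lemma abelSum_eq_add (m : ℕ) (s : ℂ) {x : ℝ} (h0 : 0 ≤ x) (h1 : x < 1) :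
    abelSum m s x = abelSum (m + 1) s x + x * abelSum (m + 1) (s + 2) x := by
  rw [abelSum, (summable_abelSum m s h0 h1).tsum_eq_zero_add, abelSum,
    (summable_abelSum (m + 1) s h0 h1).tsum_eq_zero_add, abelSum, ← tsum_mul_left, add_assoc,
    ← Summable.tsum_add ((summable_nat_add_iff 1).2 (summable_abelSum (m + 1) s h0 h1))
      ((summable_abelSum (m + 1) (s + 2) h0 h1).mul_left _)]
  congr 1
  · simp [binomCoeff_zero]
  · refine tsum_congr fun k => ?_
    rw [binomCoeff_succ_eq_add]
    push_cast
    rw [show (2 * (k + 1) + s : ℂ) = 2 * k + (s + 2) by ring]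
    ring

/-- Integration by parts in the Mellin transform, on the level of coefficients. -/
lemma mul_abelSum (m : ℕ) {s : ℂ} (hs : ∀ k : ℕ, (2 * k + s : ℂ) ≠ 0) {x : ℝ} (h0 : 0 ≤ x)
    (h1 : x < 1) :
    s * abelSum m s x =
      (((1 + x : ℂ)) ^ (m + 1))⁻¹ + 2 * (m + 1) * (x * abelSum (m + 1) (s + 2) x) := by
  have hb := hasSum_binomCoeff m (z := x) (by rwa [norm_real, Real.norm_of_nonneg h0])
  have h := ((summable_abelSum m s h0 h1).mul_left s).hasSum.sub hb
  have key := h.tsum_eq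
  rw [tsum_mul_left, ← abelSum, h.summable.tsum_eq_zero_add] at key
  rw [← sub_eq_iff_eq_add', ← key, abelSum, ← tsum_mul_left, ← tsum_mul_left]
  have e0 : s * (binomCoeff m 0 * (x : ℂ) ^ 0 * (2 * ((0 : ℕ) : ℂ) + s)⁻¹)
      - binomCoeff m 0 * (x : ℂ) ^ 0 = 0 := by
    have := hs 0
    simp only [Nat.cast_zero, mul_zero, zero_add] at this
    simp [binomCoeff_zero, this]
  rw [e0, zero_add]
  refine tsum_congr fun k => ?_
  have hk := hs (k + 1)
  have hr := succ_mul_binomCoeff_succ m k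
  push_cast at hk ⊢
  rw [show (2 * k + (s + 2) : ℂ) = 2 * (k + 1) + s by ring]
  field_simp
  linear_combination (-2 : ℂ) * x ^ (k + 1) * hr

lemma intervalIntegrable_cpow_sub_one {s : ℂ} (hs : 0 < s.re) (a b : ℝ) :
    IntervalIntegrable (fun t : ℝ => (t : ℂ) ^ (s - 1)) volume a b :=
  intervalIntegral.intervalIntegrable_cpow' (by simpa using hs)

lemma abelSum_eq_integral (m : ℕ) {s : ℂ} (hs : 0 < s.re) {x : ℝ} (h0 : 0 ≤ x) (h1 : x < 1) :
    abelSum m s x =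
      ∫ t : ℝ in (0 : ℝ)..1, (t : ℂ) ^ (s - 1) * ((1 + x * (t : ℂ) ^ 2) ^ (m + 1))⁻¹ := by
  have hint := intervalIntegrable_cpow_sub_one hs 0 1
  rw [intervalIntegrable_iff_integrableOn_Ioc_of_le zero_le_one] at hint
  have hpow : ∀ k : ℕ, Continuous fun t : ℝ => binomCoeff m k * (x * (t : ℂ) ^ 2) ^ k :=
    fun k => by fun_prop
  have hle : ∀ k : ℕ, ∀ t ∈ Ioc (0 : ℝ) 1, ‖binomCoeff m k * (x * (t : ℂ) ^ 2) ^ k‖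
      ≤ ‖binomCoeff m k‖ * x ^ k := by
    intro k t ht
    rw [norm_mul, norm_pow, norm_mul, norm_pow, norm_real, norm_real, Real.norm_of_nonneg h0,
      Real.norm_of_nonneg ht.1.le]
    gcongr
    exact mul_le_of_le_one_right h0 (pow_le_one₀ ht.1.le ht.2)
  have hF : ∀ k : ℕ, IntegrableOn
      (fun t : ℝ => (binomCoeff m k * (x * (t : ℂ) ^ 2) ^ k) * (t : ℂ) ^ (s - 1)) (Ioc 0 1) := by
    intro k
    refine Integrable.bdd_mul (c := ‖binomCoeff m k‖ * x ^ k) hint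
      (hpow k).aestronglyMeasurable ?_
    exact (ae_restrict_iff' measurableSet_Ioc).2 (ae_of_all _ (hle k))
  have hsum := hasSum_integral_of_summable_integral_norm hF (by
    refine Summable.of_nonneg_of_le (fun k => integral_nonneg fun t => norm_nonneg _) (fun k => ?_)
      ((summable_norm_binomCoeff m h0 h1).mul_right (∫ t : ℝ in Ioc 0 1, ‖(t : ℂ) ^ (s - 1)‖))
    rw [← integral_const_mul]
    refine setIntegral_mono_on (hF k).norm (hint.norm.const_mul _) measurableSet_Ioc fun t ht => ?_
    rw [norm_mul]
    gcongr
    exact hle k t ht)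
  rw [abelSum, intervalIntegral.integral_of_le zero_le_one]
  have hterm : ∀ k : ℕ, ∫ t : ℝ in Ioc 0 1,
      (binomCoeff m k * (x * (t : ℂ) ^ 2) ^ k) * (t : ℂ) ^ (s - 1)
        = binomCoeff m k * (x : ℂ) ^ k * (2 * k + s)⁻¹ := by
    intro k
    have hre : 0 < (2 * k + s : ℂ).re := by
      have : (0 : ℝ) ≤ k := k.cast_nonneg
      simp
      positivity
    have hne : (2 * k + s : ℂ) ≠ 0 := fun h => by simp [h] at hre
    have h2 : ∫ t : ℝ in (0 : ℝ)..1, (t : ℂ) ^ (2 * k + s - 1 : ℂ) = (2 * k + s : ℂ)⁻¹ := by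
      rw [integral_cpow (Or.inl (by rw [sub_re, one_re]; linarith))]
      simp [hne]
    rw [← h2, intervalIntegral.integral_of_le zero_le_one, ← integral_const_mul]
    refine setIntegral_congr_fun measurableSet_Ioc fun t ht => ?_
    have ht0 : (t : ℂ) ≠ 0 := ofReal_ne_zero.2 ht.1.ne'
    have : (t : ℂ) ^ (2 * k + s - 1 : ℂ) = ((t : ℂ) ^ 2) ^ k * (t : ℂ) ^ (s - 1) := by
      rw [add_sub_assoc, cpow_add _ _ ht0, ← pow_mul, ← cpow_natCast]
      push_cast
      rfl
    simp only [this, mul_pow]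
    ring
  simp_rw [hterm] at hsum
  rw [hsum.tsum_eq]
  refine setIntegral_congr_fun measurableSet_Ioc fun t ht => ?_
  have hlt : ‖(x * (t : ℂ) ^ 2 : ℂ)‖ < 1 := by
    rw [norm_mul, norm_pow, norm_real, norm_real, Real.norm_of_nonneg h0,
      Real.norm_of_nonneg ht.1.le]
    exact (mul_le_of_le_one_right h0 (pow_le_one₀ ht.1.le ht.2)).trans_lt h1
  simp only [tsum_mul_right, (hasSum_binomCoeff m hlt).tsum_eq]
  rw [mul_comm]

/-! ### Abel limits and Euler's beta integral -/

/-- The value at `x = 1` of the Mellin transform in `abelSum`. -/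
noncomputable def halfBeta (m : ℕ) (s : ℂ) : ℂ :=
  ∫ t : ℝ in (0 : ℝ)..1, (t : ℂ) ^ (s - 1) * ((1 + (t : ℂ) ^ 2) ^ (m + 1))⁻¹

lemma tendsto_abelSum_of_re_pos (m : ℕ) {s : ℂ} (hs : 0 < s.re) :
    Tendsto (abelSum m s) (𝓝[<] 1) (𝓝 (halfBeta m s)) := by
  have hev : ∀ᶠ x : ℝ in 𝓝[<] 1, x ∈ Ioo (0 : ℝ) 1 := Ioo_mem_nhdsLT zero_lt_one
  refine Tendsto.congr' (hev.mono fun x hx => (abelSum_eq_integral m hs hx.1.le hx.2).symm) ?_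
  have hint := intervalIntegrable_cpow_sub_one hs 0 1
  have hpos : ∀ x : ℝ, 0 < x → ∀ t : ℝ, (1 : ℝ) ≤ (1 + x * t ^ 2) ^ (m + 1) := fun x hx t =>
    one_le_pow₀ (le_add_of_nonneg_right (by positivity))
  refine intervalIntegral.tendsto_integral_filter_of_dominated_convergence
    (fun t : ℝ => ‖(t : ℂ) ^ (s - 1)‖) ?_ ?_ hint.norm ?_
  · refine Eventually.of_forall fun x => ?_
    exact hint.def'.aestronglyMeasurable.mul (by fun_prop)
  · filter_upwards [hev] with x hx
    refine ae_of_all _ fun t _ => ?_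
    rw [norm_mul]
    refine mul_le_of_le_one_right (norm_nonneg _) ?_
    have h := hpos x hx.1 t
    have e : ((1 + x * (t : ℂ) ^ 2) ^ (m + 1))⁻¹ = (((1 + x * t ^ 2) ^ (m + 1) : ℝ) : ℂ)⁻¹ := by
      push_cast
      rfl
    rw [e, norm_inv, norm_real, Real.norm_of_nonneg (zero_le_one.trans h)]
    exact inv_le_one_of_one_le₀ h
  · refine ae_of_all _ fun t _ => ?_
    refine Tendsto.const_mul _ (Tendsto.mono_left ?_ nhdsWithin_le_nhds)
    have hne : ((1 + ((1 : ℝ) : ℂ) * (t : ℂ) ^ 2) ^ (m + 1)) ≠ 0 := by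
      have := (zero_lt_one.trans_le (hpos 1 one_pos t)).ne'
      exact_mod_cast this
    have hc : ContinuousAt (fun x : ℝ => ((1 + (x : ℂ) * (t : ℂ) ^ 2) ^ (m + 1))⁻¹) 1 :=
      ContinuousAt.inv₀ (by fun_prop) hne
    simpa using hc.tendsto

/-- The substitution `y = t² / (1 + t²)` turns `halfBeta` into one half of Euler's integral. -/
lemma halfBeta_eq_integral (m : ℕ) {s s' : ℂ} (hss : s + s' = 2 * (m + 1)) :
    2 * halfBeta m s =
      ∫ y : ℝ in (0 : ℝ)..(1 / 2), (y : ℂ) ^ (s / 2 - 1) * (1 - (y : ℂ)) ^ (s' / 2 - 1) := by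
  have hpos : ∀ t : ℝ, (0 : ℝ) < 1 + t ^ 2 := fun t => by positivity
  have h := intervalIntegral.integral_deriv_smul_comp_of_deriv_nonneg (a := 0) (b := 1)
    (f := fun t : ℝ => t ^ 2 / (1 + t ^ 2)) (f' := fun t : ℝ => 2 * t / (1 + t ^ 2) ^ 2)
    (g := fun y : ℝ => (y : ℂ) ^ (s / 2 - 1) * (1 - (y : ℂ)) ^ (s' / 2 - 1))
    (Continuous.continuousOn (Continuous.div (by fun_prop) (by fun_prop) fun t => (hpos t).ne'))
    (fun t _ => by
      have hd := (hasDerivAt_pow 2 t).div ((hasDerivAt_pow 2 t).const_add 1) (hpos t).ne'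
      convert! hd using 1
      congr 1
      push_cast
      ring)
    (fun t ht => by
      have : 0 < t := by simpa using ht.1
      have := hpos t
      positivity)
  norm_num at h
  rw [← h, halfBeta, ← intervalIntegral.integral_const_mul]
  refine intervalIntegral.integral_congr_ae (ae_of_all _ fun t ht => ?_)
  rw [uIoc_of_le zero_le_one] at ht
  have ht0 := ht.1
  have hq : (0 : ℝ) < (1 + t ^ 2)⁻¹ := inv_pos.2 (hpos t)
  have htc : (t : ℂ) ≠ 0 := ofReal_ne_zero.2 ht0.ne'
  have hqc : (((1 + t ^ 2)⁻¹ : ℝ) : ℂ) ≠ 0 := ofReal_ne_zero.2 hq.ne'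
  have h1c : (1 + (t : ℂ) ^ 2) ≠ 0 := by exact_mod_cast (hpos t).ne'
  have e1 : ((t : ℂ) ^ 2 / (1 + (t : ℂ) ^ 2)) ^ (s / 2 - 1)
      = (t : ℂ) ^ (s - 2) * (((1 + t ^ 2)⁻¹ : ℝ) : ℂ) ^ (s / 2 - 1) := by
    have : ((t : ℂ) ^ 2 / (1 + (t : ℂ) ^ 2)) = ((t ^ 2 : ℝ) : ℂ) * (((1 + t ^ 2)⁻¹ : ℝ) : ℂ) := by
      push_cast
      rw [div_eq_mul_inv]
    rw [this, mul_cpow_ofReal_nonneg (by positivity) hq.le, pow_two, ofReal_mul,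
      mul_cpow_ofReal_nonneg ht0.le ht0.le, ← cpow_add _ _ htc]
    ring_nf
  have e2 : (1 - (t : ℂ) ^ 2 / (1 + (t : ℂ) ^ 2)) = (((1 + t ^ 2)⁻¹ : ℝ) : ℂ) := by
    push_cast
    field_simp
    ring
  have e3 : (((1 + t ^ 2)⁻¹ : ℝ) : ℂ) ^ (s / 2 - 1) * (((1 + t ^ 2)⁻¹ : ℝ) : ℂ) ^ (s' / 2 - 1)
      * (((1 + t ^ 2)⁻¹ : ℝ) : ℂ) ^ 2 = (((1 + t ^ 2)⁻¹ : ℝ) : ℂ) ^ (m + 1) := by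
    rw [← cpow_natCast _ 2, ← cpow_natCast _ (m + 1), ← cpow_add _ _ hqc, ← cpow_add _ _ hqc]
    congr 1
    push_cast
    linear_combination hss / 2
  have e4 : (t : ℂ) ^ (s - 1) = (t : ℂ) ^ (s - 2) * t := by
    rw [show s - 1 = s - 2 + 1 by ring, cpow_add _ _ htc, cpow_one]
  have e5 : ((1 + (t : ℂ) ^ 2))⁻¹ = (((1 + t ^ 2)⁻¹ : ℝ) : ℂ) := by
    push_cast
    rfl
  rw [e1, e2, e4, ← inv_pow, e5, ← e3, ← e5]
  field_simp

lemma halfBeta_add_halfBeta (m : ℕ) {s s' : ℂ} (hss : s + s' = 2 * (m + 1)) (hs : 0 < s.re)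
    (hs' : 0 < s'.re) :
    halfBeta m s + halfBeta m s' =
      Gamma (s / 2) * Gamma (s' / 2) / (2 * (m.factorial : ℂ)) := by
  have hu : 0 < (s / 2).re := by simpa using hs
  have hv : 0 < (s' / 2).re := by simpa using hs'
  have hconv := betaIntegral_convergent hu hv
  have hsplit : betaIntegral (s / 2) (s' / 2) = 2 * halfBeta m s + 2 * halfBeta m s' := by
    have hsub : ∀ c d : ℝ, c ∈ Icc (0 : ℝ) 1 → d ∈ Icc (0 : ℝ) 1 → IntervalIntegrable
        (fun y : ℝ => (y : ℂ) ^ (s / 2 - 1) * (1 - (y : ℂ)) ^ (s' / 2 - 1)) volume c d := by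
      intro c d hc hd
      refine hconv.mono_set ?_
      rw [uIcc_of_le zero_le_one]
      exact uIcc_subset_Icc hc hd
    have hmem : (1 / 2 : ℝ) ∈ Icc (0 : ℝ) 1 := by constructor <;> norm_num
    rw [betaIntegral, ← intervalIntegral.integral_add_adjacent_intervals
      (hsub 0 (1 / 2) (by simp) hmem) (hsub (1 / 2) 1 hmem (by simp)), halfBeta_eq_integral m hss,
      halfBeta_eq_integral m (by rw [add_comm, hss])]
    congr 1
    have h := intervalIntegral.integral_comp_sub_left (a := (0 : ℝ)) (b := 1 / 2)
      (fun y : ℝ => (y : ℂ) ^ (s / 2 - 1) * (1 - (y : ℂ)) ^ (s' / 2 - 1)) 1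
    norm_num at h
    rw [← h]
    refine intervalIntegral.integral_congr fun y _ => ?_
    simp only [mul_comm]
  have hG : Gamma (s / 2 + s' / 2) = m.factorial := by
    rw [← Gamma_nat_eq_factorial]
    congr 1
    linear_combination hss / 2
  rw [Gamma_mul_Gamma_eq_betaIntegral hu hv, hG, hsplit]
  have : (m.factorial : ℂ) ≠ 0 := Nat.cast_ne_zero.2 m.factorial_ne_zero
  field_simp

/-- The Abel sums `abelSum m s` and `abelSum m s'` both have limits at `1`, and these limits add up to
`Γ(s / 2) Γ(s' / 2) / (2 m!)`. Separate limits are part of the notion because `HasAbelLimit.of_succ`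
involves one of the two sums with an extra factor `x`. -/
def HasAbelLimit (m : ℕ) (s s' : ℂ) : Prop :=
  ∃ L L' : ℂ, Tendsto (abelSum m s) (𝓝[<] 1) (𝓝 L) ∧ Tendsto (abelSum m s') (𝓝[<] 1) (𝓝 L') ∧
    L + L' = Gamma (s / 2) * Gamma (s' / 2) / (2 * (m.factorial : ℂ))

lemma HasAbelLimit.symm {m : ℕ} {s s' : ℂ} (h : HasAbelLimit m s s') : HasAbelLimit m s' s := by
  obtain ⟨L, L', h1, h2, h3⟩ := h
  exact ⟨L', L, h2, h1, by rw [add_comm, h3, mul_comm (Gamma _)]⟩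

/-- The counterpart of `Γ(s / 2 + 1) = s / 2 * Γ(s / 2)` for Abel sums. It raises the real part of
`s` at the cost of raising `m`, and keeps the relation `s + s' = 2 * (m + 1)`. -/
lemma HasAbelLimit.of_succ {m : ℕ} {s s' : ℂ} (hss : s + s' = 2 * (m + 1))
    (hs : ∀ k : ℕ, (2 * k + s : ℂ) ≠ 0) (hs' : ∀ k : ℕ, (2 * k + s' : ℂ) ≠ 0)
    (h : HasAbelLimit (m + 1) (s + 2) s') : HasAbelLimit m s s' := by
  obtain ⟨L, L', hL, hL', hsum⟩ := h
  have hs0 : s ≠ 0 := by simpa using hs 0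
  have hev : ∀ᶠ x : ℝ in 𝓝[<] 1, x ∈ Ioo (0 : ℝ) 1 := Ioo_mem_nhdsLT zero_lt_one
  have hx : Tendsto (fun x : ℝ => (x : ℂ)) (𝓝[<] 1) (𝓝 1) := by
    have : Tendsto (fun x : ℝ => (x : ℂ)) (𝓝 1) (𝓝 ((1 : ℝ) : ℂ)) :=
      continuous_ofReal.continuousAt.tendsto
    simpa using this.mono_left nhdsWithin_le_nhds
  have hc : Tendsto (fun x : ℝ => (((1 + x : ℂ)) ^ (m + 1))⁻¹) (𝓝[<] 1)
      (𝓝 (((1 + 1 : ℂ)) ^ (m + 1))⁻¹) :=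
    ((hx.const_add 1).pow _).inv₀ (pow_ne_zero _ (by norm_num))
  -- The two limits are obtained by solving the recursions of `mul_abelSum` and `abelSum_eq_add`; by
  -- `s + s' = 2 * (m + 1)` also the second one has leading coefficient `s`.
  refine ⟨s⁻¹ * ((((1 + 1 : ℂ)) ^ (m + 1))⁻¹ + 2 * (m + 1) * (1 * L)),
    s⁻¹ * (2 * (m + 1) * L' - (((1 + 1 : ℂ)) ^ (m + 1))⁻¹), ?_, ?_, ?_⟩
  · refine Tendsto.congr' ?_ ((hc.add ((hx.mul hL).const_mul _)).const_mul _)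
    filter_upwards [hev] with x hx
    rw [← mul_abelSum m hs hx.1.le hx.2, inv_mul_cancel_left₀ hs0]
  · refine Tendsto.congr' ?_ (((hL'.const_mul _).sub hc).const_mul _)
    filter_upwards [hev] with x hx
    have h1 := mul_abelSum m hs' hx.1.le hx.2
    have h2 := abelSum_eq_add m s' hx.1.le hx.2
    rw [inv_mul_eq_iff_eq_mul₀ hs0]
    linear_combination h1 - 2 * ((m : ℂ) + 1) * h2 - abelSum m s' x * hss
  · have hG : Gamma ((s + 2) / 2) = s / 2 * Gamma (s / 2) := by
      rw [← Gamma_add_one _ (div_ne_zero hs0 two_ne_zero)]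
      ring_nf
    rw [hG, Nat.factorial_succ] at hsum
    have hm : (m : ℂ) + 1 ≠ 0 := Nat.cast_add_one_ne_zero m
    have hf : (m.factorial : ℂ) ≠ 0 := Nat.cast_ne_zero.2 m.factorial_ne_zero
    push_cast at hsum
    calc _ = s⁻¹ * (2 * (m + 1)) * (L + L') := by ring
      _ = _ := by rw [hsum]; field_simp

lemma hasAbelLimit (m : ℕ) {s s' : ℂ} (hss : s + s' = 2 * (m + 1))
    (hs : ∀ k : ℕ, (2 * k + s : ℂ) ≠ 0) (hs' : ∀ k : ℕ, (2 * k + s' : ℂ) ≠ 0) :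
    HasAbelLimit m s s' := by
  -- Induction on the number of shifts `s ↦ s + 2`, `s' ↦ s' + 2` that make both real parts positive.
  have key : ∀ N a b m : ℕ, ∀ s s' : ℂ, a + b = N → 0 < s.re + 2 * a → 0 < s'.re + 2 * b →
      s + s' = 2 * (m + 1) → (∀ k : ℕ, (2 * k + s : ℂ) ≠ 0) → (∀ k : ℕ, (2 * k + s' : ℂ) ≠ 0) →
      HasAbelLimit m s s' := by
    intro N
    induction N with
    | zero =>
      intro a b m s s' hab ha hb hss hs hs'
      obtain ⟨rfl, rfl⟩ : a = 0 ∧ b = 0 := by omega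
      have ha' : 0 < s.re := by simpa using ha
      have hb' : 0 < s'.re := by simpa using hb
      exact ⟨_, _, tendsto_abelSum_of_re_pos m ha', tendsto_abelSum_of_re_pos m hb',
        halfBeta_add_halfBeta m hss ha' hb'⟩
    | succ N ih =>
      have shift : ∀ a b m : ℕ, ∀ s s' : ℂ, a + 1 + b = N + 1 → 0 < s.re + 2 * (a + 1 : ℕ) →
          0 < s'.re + 2 * b → s + s' = 2 * (m + 1) → (∀ k : ℕ, (2 * k + s : ℂ) ≠ 0) →
          (∀ k : ℕ, (2 * k + s' : ℂ) ≠ 0) → HasAbelLimit m s s' := by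
        intro a b m s s' hab ha hb hss hs hs'
        refine .of_succ hss hs hs' (ih a b (m + 1) (s + 2) s' (by omega) ?_ hb ?_ (fun k => ?_) hs')
        · push_cast at ha
          rw [add_re, re_ofNat]
          linarith
        · push_cast
          linear_combination hss
        · have := hs (k + 1)
          push_cast at this
          rwa [show (2 * k + (s + 2) : ℂ) = 2 * (k + 1) + s by ring]
      intro a b m s s' hab ha hb hss hs hs'
      rcases a with _ | a
      · obtain ⟨b, rfl⟩ : ∃ c, b = c + 1 := ⟨b - 1, by omega⟩
        exact (shift b 0 m s' s (by omega) hb ha (by rw [add_comm, hss]) hs' hs).symm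
      · exact shift a b m s s' hab ha hb hss hs hs'
  obtain ⟨a, ha⟩ := exists_nat_gt (-s.re)
  obtain ⟨b, hb⟩ := exists_nat_gt (-s'.re)
  have ha0 : (0 : ℝ) ≤ a := a.cast_nonneg
  have hb0 : (0 : ℝ) ≤ b := b.cast_nonneg
  exact key _ a b m s s' rfl (by linarith) (by linarith) hss hs hs'

/-! ### Test functions as iterated primitives -/

/-- `IsIterPrimitive a b m g h` says that `g` is obtained on `[a, b]` from the essentially bounded
function `h` by taking `m` primitives, each of which vanishes at both end points. For `m = 0` the
functions agree almost everywhere. -/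
def IsIterPrimitive (a b : ℝ) (h : ℝ → ℂ) : ℕ → (ℝ → ℂ) → Prop
  | 0, g => MemLp h ⊤ (volume.restrict (Icc a b)) ∧ g =ᵐ[volume.restrict (Icc a b)] h
  | m + 1, g => ∃ g' : ℝ → ℂ, IsIterPrimitive a b h m g' ∧
      (∀ x ∈ Icc a b, g x = ∫ t in a..x, g' t) ∧ ∫ t in a..b, g' t = 0

lemma exists_isIterPrimitive_of_isTestFunction {a b : ℝ} (hab : a < b) {m : ℕ} {g : ℝ → ℂ}
    (hg : IsTestFunction (m + 1) a b g) : ∃ h, IsIterPrimitive a b h m g := by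
  obtain ⟨h, hh, hd⟩ := hg.bounded_deriv
  refine ⟨h, ?_⟩
  rw [Nat.add_sub_cancel] at hd
  rcases m with _ | m
  · exact ⟨hh, hd⟩
  have hdiff := hg.contDiffOn m (by omega)
  have huniq := uniqueDiffOn_Icc hab
  -- The derivative of order `m - i` is an `(i + 1)`-fold primitive of `h`.
  have key : ∀ i j : ℕ, i + j = m →
      IsIterPrimitive a b h (i + 1) (iteratedDerivWithin j g (Icc a b)) := by
    intro i
    induction i with
    | zero =>
      intro j hj
      obtain rfl : j = m := by omega
      have hl := hg.left_eq_zero j (by omega)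
      have hr := hg.right_eq_zero j (by omega)
      refine ⟨h, ⟨hh, ae_eq_refl _⟩, fun x hx => ?_, ?_⟩
      · rw [hd x hx, hl, zero_add]
      · have := hd b (right_mem_Icc.2 hab.le)
        rwa [hl, hr, zero_add, eq_comm] at this
    | succ i ih =>
      intro j hj
      have hl := hg.left_eq_zero j (by omega)
      have hr := hg.right_eq_zero j (by omega)
      have hint : ∀ x ∈ Icc a b, iteratedDerivWithin j g (Icc a b) x =
          ∫ t in a..x, iteratedDerivWithin (j + 1) g (Icc a b) t := by
        intro x hx
        have hsub : Icc a x ⊆ Icc a b := Icc_subset_Icc_right hx.2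
        have hcont := (hdiff.continuousOn_iteratedDerivWithin (m := j + 1)
          (by exact_mod_cast (by omega : j + 1 ≤ m)) huniq).mono hsub
        have hcont0 := (hdiff.continuousOn_iteratedDerivWithin (m := j)
          (by exact_mod_cast (by omega : j ≤ m)) huniq).mono hsub
        rw [intervalIntegral.integral_eq_sub_of_hasDeriv_right_of_le hx.1 hcont0 (fun t ht => ?_)
          (hcont.intervalIntegrable_of_Icc hx.1), hl, sub_zero]
        have hdt : DifferentiableWithinAt ℝ (iteratedDerivWithin j g (Icc a b)) (Icc a b) t :=
          hdiff.differentiableOn_iteratedDerivWithin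
            (by exact_mod_cast (by omega : j < m)) huniq t (hsub (Ioo_subset_Icc_self ht))
        have hda := hdt.hasDerivWithinAt
        rw [← iteratedDerivWithin_succ] at hda
        exact (hda.hasDerivAt (Icc_mem_nhds ht.1 (ht.2.trans_le hx.2))).hasDerivWithinAt
      refine ⟨_, ih (j + 1) (by omega), hint, ?_⟩
      rw [← hint b (right_mem_Icc.2 hab.le), hr]
  simpa using key m 0 (by omega)

lemma IsIterPrimitive.comp_add_right {a b : ℝ} {h : ℝ → ℂ} (c : ℝ) {m : ℕ} {g : ℝ → ℂ}
    (hg : IsIterPrimitive a b h m g) :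
    IsIterPrimitive (a - c) (b - c) (fun x => h (x + c)) m (fun x => g (x + c)) := by
  induction m generalizing g with
  | zero =>
    have hmp : MeasurePreserving (fun x : ℝ => x + c) (volume.restrict (Icc (a - c) (b - c)))
        (volume.restrict (Icc a b)) := by
      have := (measurePreserving_add_right volume c).restrict_preimage
        (measurableSet_Icc (a := a) (b := b))
      rwa [preimage_add_const_Icc] at this
    exact ⟨hg.1.comp_measurePreserving hmp, hmp.quasiMeasurePreserving.ae_eq_comp hg.2⟩
  | succ m ih =>
    obtain ⟨g', hg', hint, hzero⟩ := hg
    refine ⟨_, ih hg', fun x hx => ?_, ?_⟩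
    · rw [intervalIntegral.integral_comp_add_right, sub_add_cancel]
      exact hint _ ⟨by linarith [hx.1], by linarith [hx.2]⟩
    · rw [intervalIntegral.integral_comp_add_right, sub_add_cancel, sub_add_cancel, hzero]

lemma IsIterPrimitive.memLp_top {a b : ℝ} {h : ℝ → ℂ} {m : ℕ} {g : ℝ → ℂ}
    (hg : IsIterPrimitive a b h m g) : MemLp h ⊤ (volume.restrict (Icc a b)) := by
  induction m generalizing g with
  | zero => exact hg.1
  | succ m ih =>
    obtain ⟨g', hg', -⟩ := hg
    exact ih hg'

lemma IsIterPrimitive.integrableOn {a b : ℝ} {h : ℝ → ℂ} {m : ℕ} {g : ℝ → ℂ}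
    (hg : IsIterPrimitive a b h m g) : IntegrableOn g (Icc a b) := by
  induction m generalizing g with
  | zero =>
    have : IntegrableOn h (Icc a b) := hg.1.integrable le_top
    exact this.congr hg.2.symm
  | succ m ih =>
    obtain ⟨g', hg', hint, -⟩ := hg
    have hc : ContinuousOn g (Icc a b) :=
      (intervalIntegral.continuousOn_primitive_Icc (ih hg')).congr fun x hx => by
        simp only [hint x hx, intervalIntegral.integral_of_le hx.1, integral_Icc_eq_integral_Ioc]
    exact hc.integrableOn_Icc

/-- An `m`-fold primitive vanishes to order `m` at both end points. -/
lemma IsIterPrimitive.exists_bound {a b : ℝ} {h : ℝ → ℂ} {m : ℕ} {g : ℝ → ℂ}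
    (hg : IsIterPrimitive a b h m g) : ∃ C : ℝ, 0 ≤ C ∧ ∀ᵐ x ∂volume.restrict (Icc a b),
      ‖g x‖ ≤ C * (x - a) ^ m ∧ ‖g x‖ ≤ C * (b - x) ^ m := by
  induction m generalizing g with
  | zero =>
    obtain ⟨C, hC⟩ : ∃ C : ℝ, ∀ᵐ x ∂volume.restrict (Icc a b), ‖h x‖ ≤ C :=
      ⟨_, ae_le_lpNorm_exponent_top hg.1⟩
    refine ⟨|C|, abs_nonneg _, ?_⟩
    filter_upwards [hC, hg.2] with x hx hgx
    rw [hgx, pow_zero, pow_zero, mul_one]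
    exact ⟨hx.trans (le_abs_self C), hx.trans (le_abs_self C)⟩
  | succ m ih =>
    obtain ⟨g', hg', hint, hzero⟩ := hg
    obtain ⟨C, hC0, hC⟩ := ih hg'
    refine ⟨C, hC0, ?_⟩
    rw [ae_restrict_iff' measurableSet_Icc] at hC ⊢
    refine ae_of_all _ fun x hx => ⟨?_, ?_⟩
    · rw [hint x hx]
      have := intervalIntegral.norm_integral_le_of_norm_le_const_ae (a := a) (b := x) (f := g')
        (C := C * (x - a) ^ m) (by
          filter_upwards [hC] with t ht hmem
          rw [uIoc_of_le hx.1] at hmem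
          refine (ht ⟨hmem.1.le, hmem.2.trans hx.2⟩).1.trans ?_
          have := hmem.1
          have := hmem.2
          gcongr)
      rwa [abs_of_nonneg (sub_nonneg.2 hx.1), mul_assoc, ← pow_succ] at this
    · have hi := (hg'.integrableOn)
      have hab := hx.1.trans hx.2
      have e : g x = -∫ t in x..b, g' t := by
        rw [hint x hx, eq_neg_iff_add_eq_zero, intervalIntegral.integral_add_adjacent_intervals _ _,
          hzero]
        · exact (intervalIntegrable_iff_integrableOn_Icc_of_le hx.1).2
            (hi.mono_set (Icc_subset_Icc_right hx.2))
        · exact (intervalIntegrable_iff_integrableOn_Icc_of_le hx.2).2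
            (hi.mono_set (Icc_subset_Icc_left hx.1))
      rw [e, norm_neg]
      have := intervalIntegral.norm_integral_le_of_norm_le_const_ae (a := x) (b := b) (f := g')
        (C := C * (b - x) ^ m) (by
          filter_upwards [hC] with t ht hmem
          rw [uIoc_of_le hx.2] at hmem
          refine (ht ⟨hx.1.trans hmem.1.le, hmem.2⟩).2.trans ?_
          have := hmem.1
          have := hmem.2
          gcongr)
      rwa [abs_of_nonneg (sub_nonneg.2 hx.2), mul_assoc, ← pow_succ] at this

/-- Integration by parts against an exponential, for a primitive with vanishing boundary values.
As `g` is only absolutely continuous, this is done by exchanging integrals over the triangle `t ≤ x`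
in `[a, b]²`. -/
lemma mul_integral_exp_mul_primitive {a b : ℝ} (hab : a ≤ b) {g g' : ℝ → ℂ}
    (hg' : IntegrableOn g' (Icc a b)) (hint : ∀ x ∈ Icc a b, g x = ∫ t in a..x, g' t)
    (hzero : ∫ t in a..b, g' t = 0) (c : ℂ) :
    c * ∫ x in a..b, exp (c * x) * g x = -∫ x in a..b, exp (c * x) * g' x := by
  have hg1 : IntegrableOn g' (Ioc a b) := hg'.mono_set Ioc_subset_Icc_self
  set μ := volume.restrict (Ioc a b) with hμ
  have hprod : Integrable (Function.uncurry fun x t : ℝ =>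
      (Ici t).indicator (fun y : ℝ => c * exp (c * y)) x * g' t) (μ.prod μ) := by
    have hset : MeasurableSet {p : ℝ × ℝ | p.2 ≤ p.1} := measurableSet_le measurable_snd measurable_fst
    have h1 : Integrable (fun p : ℝ × ℝ => (c * exp (c * p.1)) * g' p.2) (μ.prod μ) := by
      refine Integrable.mul_prod (f := fun y : ℝ => c * exp (c * y)) ?_ hg1
      exact (Continuous.integrableOn_Icc (by fun_prop)).mono_set Ioc_subset_Icc_self
    refine (h1.indicator hset).congr (ae_of_all _ fun p => ?_)
    by_cases hp : p.2 ≤ p.1 <;> simp [Function.uncurry, indicator, hp]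
  have hswap := integral_integral_swap hprod
  have hL : ∀ x ∈ Ioc a b, ∫ t, (Ici t).indicator (fun y : ℝ => c * exp (c * y)) x * g' t ∂μ
      = c * (exp (c * x) * g x) := by
    intro x hx
    rw [hint x (Ioc_subset_Icc_self hx), intervalIntegral.integral_of_le hx.1.le, ← mul_assoc,
      ← integral_const_mul]
    have hs : Ioc a x ⊆ Ioc a b := Ioc_subset_Ioc_right hx.2
    rw [hμ, ← integral_indicator measurableSet_Ioc, ← integral_indicator measurableSet_Ioc]
    congr 1
    ext t
    by_cases h1 : t ∈ Ioc a x
    · simp [indicator, h1, hs h1, h1.2]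
    · by_cases h2 : t ∈ Ioc a b
      · have : ¬ t ≤ x := fun h => h1 ⟨h2.1, h⟩
        simp [indicator, h1, h2, this]
      · simp [indicator, h1, h2]
  have hR : ∀ t ∈ Ioc a b, ∫ x, (Ici t).indicator (fun y : ℝ => c * exp (c * y)) x * g' t ∂μ
      = exp (c * b) * g' t - exp (c * t) * g' t := by
    intro t ht
    rw [integral_mul_const, integral_indicator measurableSet_Ici, hμ,
      Measure.restrict_restrict measurableSet_Ici]
    have e : Ici t ∩ Ioc a b = Icc t b := by
      ext y
      simp only [mem_inter_iff, mem_Ici, mem_Ioc, mem_Icc]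
      exact ⟨fun h => ⟨h.1, h.2.2⟩, fun h => ⟨h.1, ht.1.trans_le h.1, h.2⟩⟩
    rw [e, integral_Icc_eq_integral_Ioc, ← intervalIntegral.integral_of_le ht.2,
      intervalIntegral.integral_eq_sub_of_hasDerivAt (f := fun y : ℝ => exp (c * y))
        (fun y _ => ?_) (Continuous.intervalIntegrable (by fun_prop) _ _), sub_mul]
    have := ((hasDerivAt_id (y : ℂ)).const_mul c).cexp.comp_ofReal
    simpa [mul_comm] using! this
  have hi2 : IntegrableOn (fun t : ℝ => exp (c * t) * g' t) (Ioc a b) :=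
    (hg'.continuousOn_mul (by fun_prop) isCompact_Icc).mono_set Ioc_subset_Icc_self
  rw [setIntegral_congr_fun measurableSet_Ioc hL, setIntegral_congr_fun measurableSet_Ioc hR,
    integral_const_mul, integral_sub (hg1.const_mul _) hi2, integral_const_mul,
    ← intervalIntegral.integral_of_le hab, ← intervalIntegral.integral_of_le hab,
    ← intervalIntegral.integral_of_le hab, hzero, mul_zero, zero_sub] at hswap
  exact hswap

lemma IsIterPrimitive.pow_mul_integral_exp {a b : ℝ} (hab : a ≤ b) {h : ℝ → ℂ} {m : ℕ}
    {g : ℝ → ℂ} (hg : IsIterPrimitive a b h m g) (c : ℂ) :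
    c ^ m * ∫ x in a..b, exp (c * x) * g x = (-1) ^ m * ∫ x in a..b, exp (c * x) * h x := by
  induction m generalizing g with
  | zero =>
    rw [pow_zero, pow_zero, one_mul, one_mul, intervalIntegral.integral_of_le hab,
      intervalIntegral.integral_of_le hab, ← integral_Icc_eq_integral_Ioc,
      ← integral_Icc_eq_integral_Ioc]
    refine integral_congr_ae ?_
    filter_upwards [hg.2] with x hx
    rw [hx]
  | succ m ih =>
    obtain ⟨g', hg', hint, hzero⟩ := hg
    rw [pow_succ, mul_assoc, mul_integral_exp_mul_primitive hab hg'.integrableOn hint hzero,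
      mul_neg, ih hg']
    ring

/-! ### Absolute convergence of the pairings -/

lemma exists_succ_mul_norm_inv_le (s : ℂ) :
    ∃ C : ℝ, 0 ≤ C ∧ ∀ k : ℕ, ((k : ℝ) + 1) * ‖(2 * k + s : ℂ)⁻¹‖ ≤ C := by
  obtain ⟨C, hC0, hC⟩ := exists_norm_inv_two_mul_add_le s
  refine ⟨1 / 2 + ‖1 - s / 2‖ * C, by positivity, fun k => ?_⟩
  by_cases hk : (2 * k + s : ℂ) = 0
  · rw [hk, inv_zero, norm_zero, mul_zero]
    positivity
  have e : ((k : ℂ) + 1) * (2 * k + s : ℂ)⁻¹ = 1 / 2 + (1 - s / 2) * (2 * k + s : ℂ)⁻¹ := by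
    linear_combination (1 / 2) * mul_inv_cancel₀ hk
  calc ((k : ℝ) + 1) * ‖(2 * k + s : ℂ)⁻¹‖ = ‖((k : ℂ) + 1) * (2 * k + s : ℂ)⁻¹‖ := by
        rw [norm_mul]
        congr 1
        norm_cast
    _ ≤ ‖(1 / 2 : ℂ)‖ + ‖(1 - s / 2) * (2 * k + s : ℂ)⁻¹‖ := e ▸ norm_add_le _ _
    _ ≤ 1 / 2 + ‖1 - s / 2‖ * C := by
        rw [norm_mul]
        gcongr
        · norm_num
        · exact hC k

/-- Bessel's inequality on an interval of length `π`, on which the functions `exp (2 i k x)` are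
orthogonal; the factor `exp (i p x)` is absorbed into `h`. -/
lemma summable_sq_norm_integral_exp {a b : ℝ} (hab : b - a = π) {h : ℝ → ℂ}
    (hh : MemLp h ⊤ (volume.restrict (Icc a b))) (p : ℂ) :
    Summable fun i : ℤ => ‖∫ x in a..b, exp (I * (2 * i + p) * x) * h x‖ ^ 2 := by
  have hlt : a < b := by linarith [Real.pi_pos]
  have hbdd : MemLp (fun x : ℝ => exp (I * p * x)) ⊤ (volume.restrict (Icc a b)) := by
    obtain ⟨C, hC⟩ := isCompact_Icc.exists_bound_of_continuousOn (s := Icc a b)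
      (f := fun x : ℝ => exp (I * p * x)) (by fun_prop)
    exact memLp_top_of_bound (Continuous.aestronglyMeasurable (by fun_prop)) C
      ((ae_restrict_iff' measurableSet_Icc).2 (ae_of_all _ hC))
  have hL2 : MemLp (fun x : ℝ => exp (I * p * x) * h x) 2 (volume.restrict (Ioc a b)) := by
    have h1 : MemLp (fun x : ℝ => exp (I * p * x) * h x) ⊤ (volume.restrict (Icc a b)) :=
      hh.mul hbdd
    exact (h1.mono_measure (Measure.restrict_mono_set _ Ioc_subset_Icc_self)).mono_exponent le_top
  have hs := (hasSum_sq_fourierCoeffOn hlt hL2).summable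
  have hs2 := ((Equiv.neg ℤ).summable_iff.2 hs).mul_left (π ^ 2)
  refine hs2.congr fun i => ?_
  have hpi : (π : ℂ) ≠ 0 := ofReal_ne_zero.2 Real.pi_ne_zero
  have e : ∀ x : ℝ, fourier (-(-i)) (x : AddCircle (b - a)) • (exp (I * p * x) * h x)
      = exp (I * (2 * i + p) * x) * h x := by
    intro x
    rw [fourier_coe_apply, smul_eq_mul, ← mul_assoc, ← exp_add, hab]
    congr 2
    push_cast
    field_simp
  simp only [Function.comp_apply, Equiv.neg_apply, fourierCoeffOn_eq_integral, e]
  rw [norm_smul, mul_pow, hab, ← mul_assoc, Real.norm_of_nonneg (by positivity)]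
  field_simp

/-- The sign `ε` covers the two kinds of exponentials in `psiTerm`. After `m` integrations by parts the
`k`-th term is at most a multiple of `1 / (k + 1)` times the norm of a Fourier coefficient of `h`, and
both factors are square summable. -/
lemma summable_binomCoeff_mul_integral_exp {a b : ℝ} (hab : b - a = π) {h : ℝ → ℂ} {m : ℕ}
    {g : ℝ → ℂ} (hg : IsIterPrimitive a b h m g) {s : ℂ} (hs : ∀ k : ℕ, (2 * k + s : ℂ) ≠ 0)
    {ε : ℂ} (hε : ε = 1 ∨ ε = -1) :
    Summable fun k : ℕ => binomCoeff m k *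
      ((2 * k + s)⁻¹ * ∫ x in a..b, exp (ε * (I * (2 * k + s)) * x) * g x) := by
  have hle : a ≤ b := by linarith [Real.pi_pos]
  set J : ℕ → ℝ := fun k => ‖∫ x in a..b, exp (ε * (I * (2 * k + s)) * x) * h x‖ with hJ
  have hJs : Summable fun k => J k ^ 2 := by
    rcases hε with rfl | rfl
    · have := (summable_sq_norm_integral_exp hab hg.memLp_top s).comp_injective Nat.cast_injective
      simpa [hJ, Function.comp_def] using this
    · have := (summable_sq_norm_integral_exp hab hg.memLp_top (-s)).comp_injective
        (neg_injective.comp Nat.cast_injective)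
      refine this.congr fun k => ?_
      simp only [hJ, Function.comp_apply]
      congr 3
      ext x
      congr 3
      push_cast
      ring
  obtain ⟨C, hC0, hC⟩ := exists_succ_mul_norm_inv_le s
  have hsq : Summable fun k : ℕ => (((k : ℝ) + 1) ^ 2)⁻¹ := by
    have := (summable_nat_add_iff 1).2 (Real.summable_nat_pow_inv.2 (one_lt_two))
    exact_mod_cast this
  refine Summable.of_norm_bounded
    (((hsq.add hJs).mul_left (((m : ℝ) + 1) ^ m * C ^ (m + 1)))) fun k => ?_
  have hk : (0 : ℝ) < (k : ℝ) + 1 := by positivity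
  have hnorm : ‖∫ x in a..b, exp (ε * (I * (2 * k + s)) * x) * g x‖
      = ‖(2 * k + s : ℂ)⁻¹‖ ^ m * J k := by
    have hc := congrArg norm (hg.pow_mul_integral_exp hle (ε * (I * (2 * k + s))))
    have hε1 : ‖ε‖ = 1 := by rcases hε with rfl | rfl <;> simp
    rw [norm_mul, norm_mul, norm_pow, norm_pow, norm_mul, norm_mul, hε1, norm_I, norm_neg, norm_one,
      one_mul, one_mul, one_pow, one_mul] at hc
    have := norm_pos_iff.2 (hs k)
    simp only [hJ]
    rw [← hc, norm_inv, inv_pow, inv_mul_cancel_left₀ (by positivity)]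
  have hbin : ‖binomCoeff m k‖ ≤ ((m : ℝ) + 1) ^ m * ((k : ℝ) + 1) ^ m := by
    rw [norm_binomCoeff, ← mul_pow]
    have h1 : (((k + m).choose m : ℕ) : ℝ) ≤ ((k : ℝ) + m) ^ m := by
      exact_mod_cast Nat.choose_le_pow (k + m) m
    refine h1.trans ?_
    gcongr
    have : (0 : ℝ) ≤ m * k := by positivity
    linarith
  have hJ0 : 0 ≤ J k := norm_nonneg _
  rw [norm_mul, norm_mul, hnorm]
  calc ‖binomCoeff m k‖ * (‖(2 * k + s : ℂ)⁻¹‖ * (‖(2 * k + s : ℂ)⁻¹‖ ^ m * J k))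
      ≤ (((m : ℝ) + 1) ^ m * ((k : ℝ) + 1) ^ m) *
          (‖(2 * k + s : ℂ)⁻¹‖ * (‖(2 * k + s : ℂ)⁻¹‖ ^ m * J k)) := by gcongr
    _ = ((m : ℝ) + 1) ^ m * (((k : ℝ) + 1) * ‖(2 * k + s : ℂ)⁻¹‖) ^ (m + 1)
          * (((k : ℝ) + 1)⁻¹ * J k) := by
        generalize ‖(2 * k + s : ℂ)⁻¹‖ = r
        rw [mul_pow, pow_succ ((k : ℝ) + 1) m]
        field_simp
        ring
    _ ≤ ((m : ℝ) + 1) ^ m * C ^ (m + 1) * ((((k : ℝ) + 1) ^ 2)⁻¹ + J k ^ 2) := by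
        gcongr
        · exact hC k
        · rw [← inv_pow]
          nlinarith [sq_nonneg (((k : ℝ) + 1)⁻¹ - J k), sq_nonneg (((k : ℝ) + 1)⁻¹ + J k)]

/-- The terms of the series in a form in which both exponents are a sign times `i (2k + s) θ`, and the
denominators are written as inverses. -/
lemma psiTerm_eq (m : ℕ) (α : ℂ) (k : ℕ) (θ : ℝ) :
    psiTerm (m + 1) α k θ = binomCoeff m k *
      ((2 * k + (m + 1 - α))⁻¹ * exp (1 * (I * (2 * k + (m + 1 - α))) * θ) +
        (2 * k + (m + 1 + α))⁻¹ * exp (-1 * (I * (2 * k + (m + 1 + α))) * θ)) := by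
  have h1 : (k + (m + 1) - 1).choose k = (k + m).choose m := by
    rw [show k + (m + 1) - 1 = k + m by omega, Nat.choose_symm_add]
  rw [psiTerm, binomCoeff, h1, div_eq_inv_mul, div_eq_inv_mul]
  push_cast
  ring_nf

lemma pairing_psiTerm_eq (m : ℕ) (α : ℂ) (k : ℕ) {a b : ℝ} (hab : a ≤ b) {g : ℝ → ℂ}
    (hg : IntegrableOn g (Icc a b)) :
    pairing a b (psiTerm (m + 1) α k) g =
      binomCoeff m k * ((2 * k + (m + 1 - α))⁻¹ *
        ∫ x in a..b, exp (1 * (I * (2 * k + (m + 1 - α))) * x) * g x) +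
      binomCoeff m k * ((2 * k + (m + 1 + α))⁻¹ *
        ∫ x in a..b, exp (-1 * (I * (2 * k + (m + 1 + α))) * x) * g x) := by
  have hi : ∀ c : ℂ, IntervalIntegrable (fun x : ℝ => exp (c * x) * g x) volume a b := fun c =>
    (intervalIntegrable_iff_integrableOn_Icc_of_le hab).2
      (hg.continuousOn_mul (by fun_prop) isCompact_Icc)
  rw [pairing, ← mul_add, ← intervalIntegral.integral_const_mul,
    ← intervalIntegral.integral_const_mul,
    ← intervalIntegral.integral_add ((hi _).const_mul _) ((hi _).const_mul _),
    ← intervalIntegral.integral_const_mul]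
  refine intervalIntegral.integral_congr fun x _ => ?_
  simp only [psiTerm_eq]
  ring

lemma summable_pairing_psiTerm {a b : ℝ} (hab : b - a = π) {h : ℝ → ℂ} {m : ℕ} {g : ℝ → ℂ}
    (hg : IsIterPrimitive a b h m g) {α : ℂ} (hs : ∀ k : ℕ, (2 * k + (m + 1 - α) : ℂ) ≠ 0)
    (hs' : ∀ k : ℕ, (2 * k + (m + 1 + α) : ℂ) ≠ 0) :
    Summable fun k : ℕ => pairing a b (psiTerm (m + 1) α k) g := by
  simp_rw [pairing_psiTerm_eq m α _ (by linarith [Real.pi_pos] : a ≤ b) hg.integrableOn]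
  exact (summable_binomCoeff_mul_integral_exp hab hg hs (Or.inl rfl)).add
    (summable_binomCoeff_mul_integral_exp hab hg hs' (Or.inr rfl))

/-! ### The Abel means of the series -/

/-- The derivative in `t` of the Abel mean `∑ x^k psiTerm (m + 1) α k t`. It vanishes for
`x = 1` where `cos t ≠ 0`. -/
noncomputable def abelKernel (m : ℕ) (α : ℂ) (x t : ℝ) : ℂ :=
  I * exp (-(I * α * t)) * (((exp (-(I * t)) + x * exp (I * t)) ^ (m + 1))⁻¹ -
    ((exp (I * t) + x * exp (-(I * t))) ^ (m + 1))⁻¹)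

lemma norm_exp_neg_I_mul_ofReal (t : ℝ) : ‖exp (-(I * t))‖ = 1 := by
  rw [show -(I * t) = I * ((-t : ℝ) : ℂ) by push_cast; ring, norm_exp_I_mul_ofReal]

lemma exp_I_mul_ofReal_re (t : ℝ) : (exp (I * t)).re = Real.cos t := by
  rw [mul_comm, exp_ofReal_mul_I_re]

lemma exp_neg_I_mul_ofReal_re (t : ℝ) : (exp (-(I * t))).re = Real.cos t := by
  rw [show -(I * t) = I * ((-t : ℝ) : ℂ) by push_cast; ring, exp_I_mul_ofReal_re, Real.cos_neg]

lemma add_ofReal_mul_ne_zero {x : ℝ} (h0 : 0 ≤ x) (h1 : x < 1) {u v : ℂ} (hu : ‖u‖ = 1)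
    (hv : ‖v‖ = 1) : u + x * v ≠ 0 := by
  intro h
  have h2 : ‖u‖ = ‖(x : ℂ) * v‖ := by rw [eq_neg_of_add_eq_zero_left h, norm_neg]
  rw [norm_mul, hu, hv, norm_real, Real.norm_of_nonneg h0, mul_one] at h2
  exact h1.ne' h2

lemma continuous_abelKernel (m : ℕ) (α : ℂ) {x : ℝ} (h0 : 0 ≤ x) (h1 : x < 1) :
    Continuous (abelKernel m α x) := by
  unfold abelKernel
  refine Continuous.mul (by fun_prop) (Continuous.sub (Continuous.inv₀ (by fun_prop) fun t => ?_)
    (Continuous.inv₀ (by fun_prop) fun t => ?_))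
  · exact pow_ne_zero _ (add_ofReal_mul_ne_zero h0 h1 (norm_exp_neg_I_mul_ofReal t)
      (norm_exp_I_mul_ofReal t))
  · exact pow_ne_zero _ (add_ofReal_mul_ne_zero h0 h1 (norm_exp_I_mul_ofReal t)
      (norm_exp_neg_I_mul_ofReal t))

lemma norm_exp_mul_ofReal_le (α : ℂ) {t : ℝ} (ht : |t| ≤ π / 2) :
    ‖exp (-(I * α * t))‖ ≤ Real.exp (‖α‖ * (π / 2)) := by
  refine (norm_exp_le_exp_norm _).trans (Real.exp_le_exp.2 ?_)
  rw [norm_neg, norm_mul, norm_mul, norm_I, one_mul, norm_real, Real.norm_eq_abs]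
  gcongr

lemma norm_abelKernel_le (m : ℕ) (α : ℂ) {x t : ℝ} (h0 : 0 ≤ x) (ht : |t| < π / 2) :
    ‖abelKernel m α x t‖ ≤ 2 * Real.exp (‖α‖ * (π / 2)) * (Real.cos t ^ (m + 1))⁻¹ := by
  have hcos : 0 < Real.cos t := Real.cos_pos_of_mem_Ioo (abs_lt.1 ht)
  have hbd : ∀ u v : ℂ, u.re = Real.cos t → v.re = Real.cos t →
      ‖((u + x * v) ^ (m + 1))⁻¹‖ ≤ (Real.cos t ^ (m + 1))⁻¹ := by
    intro u v hu hv
    rw [norm_inv, norm_pow]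
    gcongr
    refine le_trans ?_ (re_le_norm _)
    rw [add_re, re_ofReal_mul, hu, hv]
    nlinarith
  have hre := exp_I_mul_ofReal_re t
  have e1 := exp_neg_I_mul_ofReal_re t
  rw [abelKernel, norm_mul, norm_mul, norm_I, one_mul]
  calc _ ≤ Real.exp (‖α‖ * (π / 2)) * ((Real.cos t ^ (m + 1))⁻¹ + (Real.cos t ^ (m + 1))⁻¹) := by
        gcongr
        · exact norm_exp_mul_ofReal_le α ht.le
        · exact (norm_sub_le _ _).trans (add_le_add (hbd _ _ e1 hre) (hbd _ _ hre e1))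
    _ = _ := by ring

lemma tendsto_abelKernel (m : ℕ) (α : ℂ) {t : ℝ} (ht : |t| < π / 2) :
    Tendsto (fun x => abelKernel m α x t) (𝓝[<] 1) (𝓝 0) := by
  have hcos : 0 < Real.cos t := Real.cos_pos_of_mem_Ioo (abs_lt.1 ht)
  have hre := exp_I_mul_ofReal_re t
  have e1 := exp_neg_I_mul_ofReal_re t
  have hne : ∀ u v : ℂ, u.re = Real.cos t → v.re = Real.cos t →
      (u + ((1 : ℝ) : ℂ) * v) ^ (m + 1) ≠ 0 := by
    intro u v hu hv
    refine pow_ne_zero _ fun h => ?_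
    have := congrArg re h
    rw [add_re, re_ofReal_mul, hu, hv, zero_re] at this
    linarith
  have hc : ContinuousAt (fun x => abelKernel m α x t) 1 := by
    unfold abelKernel
    exact ContinuousAt.mul (by fun_prop) (ContinuousAt.sub
      (ContinuousAt.inv₀ (by fun_prop) (hne _ _ e1 hre))
      (ContinuousAt.inv₀ (by fun_prop) (hne _ _ hre e1)))
  have h0 : abelKernel m α 1 t = 0 := by
    simp [abelKernel, add_comm]
  simpa [h0] using hc.tendsto.mono_left nhdsWithin_le_nhds

/-- The derivative of `psiTerm (m + 1) α k`. -/
noncomputable def psiTermDeriv (m : ℕ) (α : ℂ) (k : ℕ) (t : ℝ) : ℂ :=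
  I * exp (-(I * α * t)) * (binomCoeff m k *
    (exp (I * t) ^ (2 * k + (m + 1)) - exp (-(I * t)) ^ (2 * k + (m + 1))))

lemma continuous_psiTermDeriv (m : ℕ) (α : ℂ) (k : ℕ) : Continuous (psiTermDeriv m α k) := by
  unfold psiTermDeriv
  fun_prop

lemma continuous_psiTerm (m : ℕ) (α : ℂ) (k : ℕ) : Continuous (psiTerm (m + 1) α k) := by
  rw [show psiTerm (m + 1) α k = _ from funext (psiTerm_eq m α k)]
  fun_prop

lemma hasDerivAt_psiTerm (m : ℕ) {α : ℂ} (hs : ∀ k : ℕ, (2 * k + (m + 1 - α) : ℂ) ≠ 0)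
    (hs' : ∀ k : ℕ, (2 * k + (m + 1 + α) : ℂ) ≠ 0) (k : ℕ) (t : ℝ) :
    HasDerivAt (psiTerm (m + 1) α k) (psiTermDeriv m α k t) t := by
  have hexp : ∀ c : ℂ, HasDerivAt (fun t : ℝ => exp (c * t)) (exp (c * t) * c) t := fun c => by
    simpa using! (((hasDerivAt_id (t : ℂ)).const_mul c).cexp).comp_ofReal
  have h := (((hexp (1 * (I * (2 * k + (m + 1 - α))))).const_mul (2 * k + (m + 1 - α) : ℂ)⁻¹).add
    ((hexp (-1 * (I * (2 * k + (m + 1 + α))))).const_mul (2 * k + (m + 1 + α) : ℂ)⁻¹)).const_mul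
    (binomCoeff m k)
  rw [show psiTerm (m + 1) α k = _ from funext (psiTerm_eq m α k)]
  refine h.congr_deriv ?_
  have e1 : exp (1 * (I * (2 * k + (m + 1 - α))) * t)
      = exp (-(I * α * t)) * exp (I * t) ^ (2 * k + (m + 1)) := by
    rw [← exp_nat_mul, ← exp_add]
    congr 1
    push_cast
    ring
  have e2 : exp (-1 * (I * (2 * k + (m + 1 + α))) * t)
      = exp (-(I * α * t)) * exp (-(I * t)) ^ (2 * k + (m + 1)) := by
    rw [← exp_nat_mul, ← exp_add]
    congr 1
    push_cast
    ring
  have h1 := hs k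
  have h2 := hs' k
  rw [e1, e2, psiTermDeriv]
  field_simp
  ring

/-- The binomial series at `x e^{2it}` and at `x e^{-2it}`. -/
lemma hasSum_psiTermDeriv (m : ℕ) (α : ℂ) {x : ℝ} (h0 : 0 ≤ x) (h1 : x < 1) (t : ℝ) :
    HasSum (fun k : ℕ => (x : ℂ) ^ k * psiTermDeriv m α k t) (abelKernel m α x t) := by
  have hmul : exp (I * t) * exp (-(I * t)) = 1 := by rw [← exp_add, add_neg_cancel, exp_zero]
  have hgen : ∀ u v : ℂ, ‖u‖ = 1 → ‖v‖ = 1 → u * v = 1 →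
      HasSum (fun k : ℕ => (x : ℂ) ^ k * (binomCoeff m k * u ^ (2 * k + (m + 1))))
        ((v + x * u) ^ (m + 1))⁻¹ := by
    intro u v hu hv huv
    have hlt : ‖(x : ℂ) * u ^ 2‖ < 1 := by
      rw [norm_mul, norm_pow, hu, norm_real, Real.norm_of_nonneg h0]
      simpa using h1
    have h := (hasSum_binomCoeff m hlt).mul_left (u ^ (m + 1))
    have e : u ^ (m + 1) * ((1 + x * u ^ 2) ^ (m + 1))⁻¹ = ((v + x * u) ^ (m + 1))⁻¹ := by
      have : (1 + x * u ^ 2) = u * (v + x * u) := by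
        rw [mul_add, huv]
        ring
      have hu0 : u ≠ 0 := left_ne_zero_of_mul_eq_one huv
      rw [this, mul_pow, mul_inv, mul_inv_cancel_left₀ (pow_ne_zero _ hu0)]
    rw [e] at h
    refine h.congr_fun fun k => ?_
    rw [pow_add, pow_mul, mul_pow]
    ring
  have h := ((hgen _ _ (norm_exp_I_mul_ofReal t) (norm_exp_neg_I_mul_ofReal t) hmul).sub
    (hgen _ _ (norm_exp_neg_I_mul_ofReal t) (norm_exp_I_mul_ofReal t)
      (by rw [mul_comm, hmul]))).mul_left (I * exp (-(I * α * t)))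
  refine h.congr_fun fun k => ?_
  rw [psiTermDeriv]
  ring

lemma norm_psiTermDeriv_le (m : ℕ) (α : ℂ) (k : ℕ) (t : ℝ) :
    ‖psiTermDeriv m α k t‖ ≤ ‖binomCoeff m k‖ * (2 * ‖exp (-(I * α * t))‖) := by
  have h : ‖exp (I * t) ^ (2 * k + (m + 1)) - exp (-(I * t)) ^ (2 * k + (m + 1))‖ ≤ 2 := by
    refine (norm_sub_le _ _).trans ?_
    rw [norm_pow, norm_pow, norm_exp_I_mul_ofReal, norm_exp_neg_I_mul_ofReal]
    norm_num
  rw [psiTermDeriv, norm_mul, norm_mul, norm_mul, norm_I, one_mul]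
  calc _ ≤ ‖exp (-(I * α * t))‖ * (‖binomCoeff m k‖ * 2) := by gcongr
    _ = _ := by ring

lemma hasSum_psiTerm_sub (m : ℕ) {α : ℂ} (hs : ∀ k : ℕ, (2 * k + (m + 1 - α) : ℂ) ≠ 0)
    (hs' : ∀ k : ℕ, (2 * k + (m + 1 + α) : ℂ) ≠ 0) {x : ℝ} (h0 : 0 ≤ x) (h1 : x < 1) (θ : ℝ) :
    HasSum (fun k : ℕ => (x : ℂ) ^ k * (psiTerm (m + 1) α k θ - psiTerm (m + 1) α k 0))
      (∫ t in (0 : ℝ)..θ, abelKernel m α x t) := by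
  have hsum := summable_norm_binomCoeff m h0 h1
  have h := intervalIntegral.hasSum_integral_of_dominated_convergence (μ := volume) (a := 0) (b := θ)
    (F := fun (k : ℕ) t => (x : ℂ) ^ k * psiTermDeriv m α k t) (f := abelKernel m α x)
    (fun k t => (‖binomCoeff m k‖ * x ^ k) * (2 * ‖exp (-(I * α * t))‖))
    (fun k => ((continuous_psiTermDeriv m α k).const_mul _).aestronglyMeasurable)
    (fun k => ae_of_all _ fun t _ => by
      rw [norm_mul, norm_pow, norm_real, Real.norm_of_nonneg h0, mul_right_comm, mul_comm]
      gcongr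
      exact norm_psiTermDeriv_le m α k t)
    (ae_of_all _ fun t _ => hsum.mul_right _)
    (by
      simp only [tsum_mul_right]
      exact Continuous.intervalIntegrable (by fun_prop) _ _)
    (ae_of_all _ fun t _ => hasSum_psiTermDeriv m α h0 h1 t)
  refine h.congr_fun fun k => ?_
  rw [intervalIntegral.integral_const_mul, intervalIntegral.integral_eq_sub_of_hasDerivAt
    (fun t _ => hasDerivAt_psiTerm m hs hs' k t)
    ((continuous_psiTermDeriv m α k).intervalIntegrable _ _)]

lemma hasSum_psiTerm_zero (m : ℕ) (α : ℂ) {x : ℝ} (h0 : 0 ≤ x) (h1 : x < 1) :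
    HasSum (fun k : ℕ => (x : ℂ) ^ k * psiTerm (m + 1) α k 0)
      (abelSum m (m + 1 - α) x + abelSum m (m + 1 + α) x) := by
  have h := (summable_abelSum m (m + 1 - α) h0 h1).hasSum.add
    (summable_abelSum m (m + 1 + α) h0 h1).hasSum
  refine h.congr_fun fun k => ?_
  rw [psiTerm_eq]
  simp only [ofReal_zero, mul_zero, exp_zero]
  ring

/-! ### Passing to the limit on `[-π/2, π/2]` -/

/-- Jordan's inequality for the cosine. -/
lemma pi_div_two_sub_abs_le {t : ℝ} (ht : |t| ≤ π / 2) : π / 2 - |t| ≤ π / 2 * Real.cos t := by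
  have h := Real.one_sub_mul_le_cos (abs_nonneg t) ht
  rw [Real.cos_abs] at h
  have := Real.pi_pos
  calc π / 2 - |t| = π / 2 * (1 - 2 / π * |t|) := by field_simp
    _ ≤ _ := by gcongr

lemma integrableOn_cos_rpow :
    IntegrableOn (fun t : ℝ => Real.cos t ^ (-(1 / 2) : ℝ)) (Ioc (-(π / 2)) (π / 2)) := by
  have hpi := Real.pi_pos
  have hle : -(π / 2) ≤ π / 2 := by linarith
  have h0 : IntervalIntegrable (fun y : ℝ => y ^ (-(1 / 2) : ℝ)) volume 0 π :=
    intervalIntegral.intervalIntegrable_rpow' (by norm_num)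
  have h1 : IntegrableOn (fun t : ℝ => (π / 2 - t) ^ (-(1 / 2) : ℝ)) (Ioc (-(π / 2)) (π / 2)) := by
    have := (h0.comp_sub_left (π / 2)).symm
    rw [show π / 2 - π = -(π / 2) by ring, sub_zero] at this
    exact (intervalIntegrable_iff_integrableOn_Ioc_of_le hle).1 this
  have h2 : IntegrableOn (fun t : ℝ => (t + π / 2) ^ (-(1 / 2) : ℝ)) (Ioc (-(π / 2)) (π / 2)) := by
    have := h0.comp_add_right (π / 2)
    rw [show π - π / 2 = π / 2 by ring, zero_sub] at this
    exact (intervalIntegrable_iff_integrableOn_Ioc_of_le hle).1 this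
  refine Integrable.mono' ((h1.add h2).const_mul ((2 / π) ^ (-(1 / 2) : ℝ)))
    (Measurable.aestronglyMeasurable (by fun_prop)) ?_
  rw [← restrict_Ioo_eq_restrict_Ioc, ae_restrict_iff' measurableSet_Ioo]
  refine ae_of_all _ fun t ht => ?_
  have hcos := Real.cos_pos_of_mem_Ioo ht
  have habs : |t| < π / 2 := abs_lt.2 ht
  rw [Real.norm_of_nonneg (by positivity)]
  have hj : 2 / π * (π / 2 - |t|) ≤ Real.cos t := by
    have := pi_div_two_sub_abs_le habs.le
    calc 2 / π * (π / 2 - |t|) ≤ 2 / π * (π / 2 * Real.cos t) := by gcongr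
      _ = Real.cos t := by field_simp
  have hd : 0 < π / 2 - |t| := by linarith
  have hl : 0 < π / 2 - t := by linarith [ht.2]
  have hr : 0 < t + π / 2 := by linarith [ht.1]
  calc Real.cos t ^ (-(1 / 2) : ℝ) ≤ (2 / π * (π / 2 - |t|)) ^ (-(1 / 2) : ℝ) :=
        Real.rpow_le_rpow_of_nonpos (by positivity) hj (by norm_num)
    _ = (2 / π) ^ (-(1 / 2) : ℝ) * (π / 2 - |t|) ^ (-(1 / 2) : ℝ) :=
        Real.mul_rpow (by positivity) hd.le
    _ ≤ (2 / π) ^ (-(1 / 2) : ℝ) *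
          ((π / 2 - t) ^ (-(1 / 2) : ℝ) + (t + π / 2) ^ (-(1 / 2) : ℝ)) := by
        gcongr
        rcases abs_cases t with ⟨h, -⟩ | ⟨h, -⟩
        · rw [h]
          exact le_add_of_nonneg_right (by positivity)
        · rw [h, sub_neg_eq_add, add_comm (π / 2)]
          exact le_add_of_nonneg_left (by positivity)

lemma abs_le_of_mem_uIoc {t θ : ℝ} (ht : t ∈ Ι 0 θ) : |t| ≤ |θ| := by
  simpa using abs_sub_left_of_mem_uIcc (uIoc_subset_uIcc ht)

lemma cos_le_cos_of_mem_uIoc {t θ : ℝ} (hθ : |θ| < π / 2) (ht : t ∈ Ι 0 θ) :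
    Real.cos θ ≤ Real.cos t := by
  rw [← Real.cos_abs θ, ← Real.cos_abs t]
  exact Real.cos_le_cos_of_nonneg_of_le_pi (abs_nonneg t) (by linarith [Real.pi_pos])
    (abs_le_of_mem_uIoc ht)

/-- Half a power of the cosine is kept under the integral, so that the bound is off from
`cos θ ^ (-m)` by an integrable factor only, also for `m = 0`. -/
lemma norm_integral_abelKernel_le (m : ℕ) (α : ℂ) {x θ : ℝ} (h0 : 0 ≤ x) (hθ : |θ| < π / 2) :
    ‖∫ t in (0 : ℝ)..θ, abelKernel m α x t‖ ≤ 2 * Real.exp (‖α‖ * (π / 2)) *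
      (((Real.cos θ ^ m)⁻¹ * Real.cos θ ^ (-(1 / 2) : ℝ)) *
        ∫ t in Ioc (-(π / 2)) (π / 2), Real.cos t ^ (-(1 / 2) : ℝ)) := by
  have hcosθ : 0 < Real.cos θ := Real.cos_pos_of_mem_Ioo (abs_lt.1 hθ)
  set M := 2 * Real.exp (‖α‖ * (π / 2)) with hM
  set K := (Real.cos θ ^ m)⁻¹ * Real.cos θ ^ (-(1 / 2) : ℝ) with hK
  have hsub : Ι 0 θ ⊆ Ioc (-(π / 2)) (π / 2) := by
    intro t ht
    have := abs_lt.1 ((abs_le_of_mem_uIoc ht).trans_lt hθ)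
    exact ⟨this.1, this.2.le⟩
  have hint := integrableOn_cos_rpow
  calc ‖∫ t in (0 : ℝ)..θ, abelKernel m α x t‖
      = ‖∫ t in Ι 0 θ, abelKernel m α x t‖ := intervalIntegral.norm_intervalIntegral_eq _ _ _ _
    _ ≤ ∫ t in Ι 0 θ, M * K * Real.cos t ^ (-(1 / 2) : ℝ) := by
        refine norm_integral_le_of_norm_le ((hint.mono_set hsub).const_mul _) ?_
        rw [ae_restrict_iff' measurableSet_uIoc]
        refine ae_of_all _ fun t ht => ?_
        have hle := cos_le_cos_of_mem_uIoc hθ ht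
        have hcost := hcosθ.trans_le hle
        refine (norm_abelKernel_le m α h0 ((abs_le_of_mem_uIoc ht).trans_lt hθ)).trans ?_
        have e : (Real.cos t ^ (m + 1))⁻¹ = (Real.cos t ^ m)⁻¹ * Real.cos t ^ (-(1 / 2) : ℝ) *
            Real.cos t ^ (-(1 / 2) : ℝ) := by
          rw [mul_assoc, ← Real.rpow_add hcost, pow_succ, mul_inv]
          norm_num [Real.rpow_neg_one]
        rw [e, ← mul_assoc M]
        have h2 : Real.cos t ^ (-(1 / 2) : ℝ) ≤ Real.cos θ ^ (-(1 / 2) : ℝ) :=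
          Real.rpow_le_rpow_of_nonpos hcosθ hle (by norm_num)
        have h3 : (Real.cos t ^ m)⁻¹ * Real.cos t ^ (-(1 / 2) : ℝ) ≤ K := by
          rw [hK]
          gcongr
        gcongr
    _ = M * K * ∫ t in Ι 0 θ, Real.cos t ^ (-(1 / 2) : ℝ) := integral_const_mul _ _
    _ ≤ M * K * ∫ t in Ioc (-(π / 2)) (π / 2), Real.cos t ^ (-(1 / 2) : ℝ) := by
        gcongr ?_ * ?_
        refine setIntegral_mono_set hint ?_ hsub.eventuallyLE
        rw [EventuallyLE, ae_restrict_iff' measurableSet_Ioc]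
        refine ae_of_all _ fun t ht => Real.rpow_nonneg ?_ _
        exact Real.cos_nonneg_of_mem_Icc (Ioc_subset_Icc_self ht)
    _ = _ := by ring

lemma tendsto_integral_abelKernel (m : ℕ) (α : ℂ) {θ : ℝ} (hθ : |θ| < π / 2) :
    Tendsto (fun x => ∫ t in (0 : ℝ)..θ, abelKernel m α x t) (𝓝[<] 1) (𝓝 0) := by
  have hcosθ : 0 < Real.cos θ := Real.cos_pos_of_mem_Ioo (abs_lt.1 hθ)
  have hev : ∀ᶠ x : ℝ in 𝓝[<] 1, x ∈ Ioo (0 : ℝ) 1 := Ioo_mem_nhdsLT zero_lt_one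
  have h := intervalIntegral.tendsto_integral_filter_of_dominated_convergence (μ := volume)
    (a := 0) (b := θ) (l := 𝓝[<] (1 : ℝ)) (F := fun x t => abelKernel m α x t) (f := fun _ => 0)
    (fun _ => 2 * Real.exp (‖α‖ * (π / 2)) * (Real.cos θ ^ (m + 1))⁻¹)
    (hev.mono fun x hx => (continuous_abelKernel m α hx.1.le hx.2).aestronglyMeasurable)
    (hev.mono fun x hx => ae_of_all _ fun t ht => by
      have hle := cos_le_cos_of_mem_uIoc hθ ht
      refine (norm_abelKernel_le m α hx.1.le ((abs_le_of_mem_uIoc ht).trans_lt hθ)).trans ?_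
      gcongr)
    (intervalIntegrable_const)
    (ae_of_all _ fun t ht => tendsto_abelKernel m α ((abs_le_of_mem_uIoc ht).trans_lt hθ))
  simpa using h

lemma tendsto_integral_integral_abelKernel_mul {h : ℝ → ℂ} {m : ℕ} {g : ℝ → ℂ} (α : ℂ)
    (hg : IsIterPrimitive (-(π / 2)) (π / 2) h m g) :
    Tendsto (fun x => ∫ θ in Ioc (-(π / 2)) (π / 2), (∫ t in (0 : ℝ)..θ, abelKernel m α x t) * g θ)
      (𝓝[<] 1) (𝓝 0) := by
  have hpi := Real.pi_pos
  have hev : ∀ᶠ x : ℝ in 𝓝[<] 1, x ∈ Ioo (0 : ℝ) 1 := Ioo_mem_nhdsLT zero_lt_one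
  obtain ⟨C, hC0, hC⟩ := hg.exists_bound
  have hgi : IntegrableOn g (Ioc (-(π / 2)) (π / 2)) := hg.integrableOn.mono_set Ioc_subset_Icc_self
  set W := ∫ t in Ioc (-(π / 2)) (π / 2), Real.cos t ^ (-(1 / 2) : ℝ)
  set M := 2 * Real.exp (‖α‖ * (π / 2))
  have hb : ∀ᵐ θ ∂volume.restrict (Ioc (-(π / 2)) (π / 2)), |θ| < π / 2 ∧
      ‖g θ‖ ≤ C * (π / 2) ^ m * Real.cos θ ^ m := by
    have hC' := ae_restrict_of_ae_restrict_of_subset Ioo_subset_Icc_self hC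
    rw [← restrict_Ioo_eq_restrict_Ioc]
    filter_upwards [hC', ae_restrict_mem measurableSet_Ioo] with θ hθ hmem
    have habs : |θ| < π / 2 := abs_lt.2 hmem
    refine ⟨habs, ?_⟩
    have hle : ‖g θ‖ ≤ C * (π / 2 - |θ|) ^ m := by
      rcases abs_cases θ with ⟨e, -⟩ | ⟨e, -⟩
      · rw [e]
        exact hθ.2
      · rw [e]
        convert hθ.1 using 3
        ring
    refine hle.trans ?_
    rw [mul_assoc, ← mul_pow]
    gcongr
    exact pi_div_two_sub_abs_le habs.le
  have key := tendsto_integral_filter_of_dominated_convergence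
    (μ := volume.restrict (Ioc (-(π / 2)) (π / 2))) (l := 𝓝[<] (1 : ℝ))
    (F := fun x θ => (∫ t in (0 : ℝ)..θ, abelKernel m α x t) * g θ) (f := fun _ => 0)
    (fun θ => M * W * C * (π / 2) ^ m * Real.cos θ ^ (-(1 / 2) : ℝ))
    (hev.mono fun x hx => ((intervalIntegral.continuous_primitive
      (fun a b => (continuous_abelKernel m α hx.1.le hx.2).intervalIntegrable a b)
      0).aestronglyMeasurable).mul hgi.aestronglyMeasurable)
    (hev.mono fun x hx => by
      filter_upwards [hb] with θ hθ
      have hcos : 0 < Real.cos θ := Real.cos_pos_of_mem_Ioo (abs_lt.1 hθ.1)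
      rw [norm_mul]
      calc _ ≤ (M * (((Real.cos θ ^ m)⁻¹ * Real.cos θ ^ (-(1 / 2) : ℝ)) * W)) *
            (C * (π / 2) ^ m * Real.cos θ ^ m) := by
            gcongr
            · exact (norm_nonneg _).trans (norm_integral_abelKernel_le m α hx.1.le hθ.1)
            · exact norm_integral_abelKernel_le m α hx.1.le hθ.1
            · exact hθ.2
        _ = M * W * C * (π / 2) ^ m * Real.cos θ ^ (-(1 / 2) : ℝ) := by
            field_simp)
    (integrableOn_cos_rpow.const_mul _)
    (by
      filter_upwards [hb] with θ hθ
      simpa using (tendsto_integral_abelKernel m α hθ.1).mul_const (g θ))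
  simpa using key

lemma exists_norm_psiTerm_le (m : ℕ) (α : ℂ) : ∃ C : ℝ, 0 ≤ C ∧ ∀ k : ℕ, ∀ θ : ℝ, |θ| ≤ π / 2 →
    ‖psiTerm (m + 1) α k θ‖ ≤ ‖binomCoeff m k‖ * C := by
  obtain ⟨C, hC0, hC⟩ := exists_norm_inv_two_mul_add_le (m + 1 - α)
  obtain ⟨D, hD0, hD⟩ := exists_norm_inv_two_mul_add_le (m + 1 + α)
  refine ⟨(C + D) * Real.exp (‖α‖ * (π / 2)), by positivity, fun k θ hθ => ?_⟩
  have hE := norm_exp_mul_ofReal_le α hθ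
  have e1 : ‖exp (1 * (I * (2 * k + (m + 1 - α))) * θ)‖ = ‖exp (-(I * α * θ))‖ := by
    simp [norm_exp]
  have e2 : ‖exp (-1 * (I * (2 * k + (m + 1 + α))) * θ)‖ = ‖exp (-(I * α * θ))‖ := by
    simp [norm_exp]
  rw [psiTerm_eq, norm_mul]
  gcongr
  refine (norm_add_le _ _).trans ?_
  rw [norm_mul, norm_mul, e1, e2, ← add_mul]
  gcongr
  · exact hC k
  · exact hD k

/-- The Abel mean of the pairings splits into the value of the Abel mean of the series at the
origin and a remainder in which only its derivative occurs. -/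
lemma hasSum_pow_mul_pairing {h : ℝ → ℂ} {m : ℕ} {g : ℝ → ℂ} {α : ℂ}
    (hg : IsIterPrimitive (-(π / 2)) (π / 2) h m g)
    (hs : ∀ k : ℕ, (2 * k + (m + 1 - α) : ℂ) ≠ 0) (hs' : ∀ k : ℕ, (2 * k + (m + 1 + α) : ℂ) ≠ 0)
    {x : ℝ} (h0 : 0 ≤ x) (h1 : x < 1) :
    HasSum (fun k : ℕ => (x : ℂ) ^ k * pairing (-(π / 2)) (π / 2) (psiTerm (m + 1) α k) g)
      ((abelSum m (m + 1 - α) x + abelSum m (m + 1 + α) x) * pairing (-(π / 2)) (π / 2) 1 g +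
        ∫ θ in Ioc (-(π / 2)) (π / 2), (∫ t in (0 : ℝ)..θ, abelKernel m α x t) * g θ) := by
  have hpi := Real.pi_pos
  have hle : -(π / 2) ≤ π / 2 := by linarith
  have hgi : IntegrableOn g (Ioc (-(π / 2)) (π / 2)) := hg.integrableOn.mono_set Ioc_subset_Icc_self
  obtain ⟨C, hC0, hC⟩ := exists_norm_psiTerm_le m α
  have hi : ∀ u : ℝ → ℂ, Continuous u → IntegrableOn (fun θ => u θ * g θ)
      (Ioc (-(π / 2)) (π / 2)) := fun u hu =>
    (hg.integrableOn.continuousOn_mul hu.continuousOn isCompact_Icc).mono_set Ioc_subset_Icc_self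
  have hF : ∀ k : ℕ, IntegrableOn (fun θ => (x : ℂ) ^ k * (psiTerm (m + 1) α k θ * g θ))
      (Ioc (-(π / 2)) (π / 2)) := fun k => (hi _ (continuous_psiTerm m α k)).const_mul _
  have hsum := hasSum_integral_of_summable_integral_norm hF (by
    refine Summable.of_nonneg_of_le (fun k => integral_nonneg fun t => norm_nonneg _) (fun k => ?_)
      ((summable_norm_binomCoeff m h0 h1).mul_right
        (C * ∫ θ in Ioc (-(π / 2)) (π / 2), ‖g θ‖))
    rw [← mul_assoc, ← integral_const_mul]
    refine setIntegral_mono_on (hF k).norm (hgi.norm.const_mul _) measurableSet_Ioc fun θ hθ => ?_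
    rw [norm_mul, norm_mul, norm_pow, norm_real, Real.norm_of_nonneg h0]
    have := hC k θ (abs_le.2 (Ioc_subset_Icc_self hθ))
    calc _ ≤ x ^ k * ((‖binomCoeff m k‖ * C) * ‖g θ‖) := by gcongr
      _ = _ := by ring)
  have hval : ∀ θ, ∑' k : ℕ, (x : ℂ) ^ k * (psiTerm (m + 1) α k θ * g θ) =
      (abelSum m (m + 1 - α) x + abelSum m (m + 1 + α) x) * g θ +
        (∫ t in (0 : ℝ)..θ, abelKernel m α x t) * g θ := by
    intro θ
    have h := ((hasSum_psiTerm_zero m α h0 h1).add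
      (hasSum_psiTerm_sub m hs hs' h0 h1 θ)).mul_right (g θ)
    rw [← add_mul, ← h.tsum_eq]
    refine tsum_congr fun k => ?_
    ring
  have hprim : Continuous fun θ => ∫ t in (0 : ℝ)..θ, abelKernel m α x t :=
    intervalIntegral.continuous_primitive
      (fun a b => (continuous_abelKernel m α h0 h1).intervalIntegrable a b) 0
  simp_rw [hval] at hsum
  rw [integral_add (hgi.const_mul _) (hi _ hprim), integral_const_mul] at hsum
  have hone : pairing (-(π / 2)) (π / 2) 1 g = ∫ θ in Ioc (-(π / 2)) (π / 2), g θ := by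
    simp [pairing, intervalIntegral.integral_of_le hle]
  rw [hone]
  refine hsum.congr_fun fun k => ?_
  rw [integral_const_mul, pairing, intervalIntegral.integral_of_le hle]

lemma psiPairing_eq_constC_mul {h : ℝ → ℂ} {m : ℕ} {g : ℝ → ℂ} {α : ℂ}
    (hg : IsIterPrimitive (-(π / 2)) (π / 2) h m g)
    (hs : ∀ k : ℕ, (2 * k + (m + 1 - α) : ℂ) ≠ 0)
    (hs' : ∀ k : ℕ, (2 * k + (m + 1 + α) : ℂ) ≠ 0) :
    psiPairing (m + 1) α (-(π / 2)) (π / 2) g =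
      constC (m + 1) α * pairing (-(π / 2)) (π / 2) 1 g := by
  have hev : ∀ᶠ x : ℝ in 𝓝[<] 1, x ∈ Ioo (0 : ℝ) 1 := Ioo_mem_nhdsLT zero_lt_one
  have hsum := summable_pairing_psiTerm (by ring : π / 2 - -(π / 2) = π) hg hs hs'
  obtain ⟨L, L', hL, hL', hLL⟩ := hasAbelLimit m (s := m + 1 - α) (s' := m + 1 + α) (by ring) hs hs'
  have hx : Tendsto (fun x : ℝ => (x : ℂ)) (𝓝[<] 1) (𝓝 1) := by
    have : Tendsto (fun x : ℝ => (x : ℂ)) (𝓝 1) (𝓝 ((1 : ℝ) : ℂ)) :=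
      continuous_ofReal.continuousAt.tendsto
    simpa using this.mono_left nhdsWithin_le_nhds
  -- Abel's theorem, in the easy case of an absolutely convergent series.
  have habel := tendsto_tsum_of_dominated_convergence (𝓕 := 𝓝[<] (1 : ℝ))
    (f := fun (x : ℝ) (k : ℕ) => (x : ℂ) ^ k * pairing (-(π / 2)) (π / 2) (psiTerm (m + 1) α k) g)
    (g := fun k : ℕ => pairing (-(π / 2)) (π / 2) (psiTerm (m + 1) α k) g) hsum.norm
    (fun k => by
      simpa using (hx.pow k).mul_const (pairing (-(π / 2)) (π / 2) (psiTerm (m + 1) α k) g))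
    (hev.mono fun x hx k => by
      rw [norm_mul, norm_pow, norm_real, Real.norm_of_nonneg hx.1.le]
      exact mul_le_of_le_one_left (norm_nonneg _) (pow_le_one₀ hx.1.le hx.2.le))
  have hlim := ((hL.add hL').mul_const (pairing (-(π / 2)) (π / 2) 1 g)).add
    (tendsto_integral_integral_abelKernel_mul α hg)
  have heq := tendsto_nhds_unique habel (hlim.congr' (hev.mono fun x hx =>
    (hasSum_pow_mul_pairing hg hs hs' hx.1.le hx.2).tsum_eq.symm))
  rw [psiPairing, heq, add_zero, hLL, constC]
  push_cast
  rw [mul_comm (Gamma ((m + 1 - α) / 2))]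

/-! ### The interval `[π/2, 3π/2]` -/

lemma psiTerm_add_pi (m : ℕ) (α : ℂ) (k : ℕ) (θ : ℝ) :
    psiTerm (m + 1) α k (θ + π) =
      (-1) ^ (m + 1) * exp (-(I * α * π)) * psiTerm (m + 1) α k θ := by
  have h1 : exp (I * π) ^ (2 * k + (m + 1)) = (-1) ^ (m + 1) := by
    rw [mul_comm I, exp_pi_mul_I, pow_add, pow_mul]
    simp
  have h2 : exp (-(I * π)) ^ (2 * k + (m + 1)) = (-1) ^ (m + 1) := by
    rw [mul_comm I, exp_neg, exp_pi_mul_I, pow_add, pow_mul]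
    norm_num
  have e1 : exp (1 * (I * (2 * k + (m + 1 - α))) * ((θ + π : ℝ) : ℂ)) =
      (-1) ^ (m + 1) * exp (-(I * α * π)) * exp (1 * (I * (2 * k + (m + 1 - α))) * θ) := by
    rw [← h1, ← exp_nat_mul, ← exp_add, ← exp_add]
    congr 1
    push_cast
    ring
  have e2 : exp (-1 * (I * (2 * k + (m + 1 + α))) * ((θ + π : ℝ) : ℂ)) =
      (-1) ^ (m + 1) * exp (-(I * α * π)) * exp (-1 * (I * (2 * k + (m + 1 + α))) * θ) := by
    rw [← h2, ← exp_nat_mul, ← exp_add, ← exp_add]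
    congr 1
    push_cast
    ring
  rw [psiTerm_eq, psiTerm_eq, e1, e2]
  ring

lemma pairing_comp_add_pi (u g : ℝ → ℂ) :
    pairing (-(π / 2)) (π / 2) (fun θ => u (θ + π)) (fun θ => g (θ + π)) =
      pairing (π / 2) (3 * π / 2) u g := by
  rw [pairing, pairing, intervalIntegral.integral_comp_add_right (fun θ => u θ * g θ)]
  congr 1 <;> ring

lemma pairing_psiTerm_eq_shift (m : ℕ) (α : ℂ) (k : ℕ) (g : ℝ → ℂ) :
    pairing (π / 2) (3 * π / 2) (psiTerm (m + 1) α k) g =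
      (-1) ^ (m + 1) * exp (-(I * α * π)) *
        pairing (-(π / 2)) (π / 2) (psiTerm (m + 1) α k) (fun θ => g (θ + π)) := by
  rw [← pairing_comp_add_pi, pairing, pairing, ← intervalIntegral.integral_const_mul]
  refine intervalIntegral.integral_congr fun θ _ => ?_
  simp only [psiTerm_add_pi]
  ring

end PsiSeries

theorem proposition2p5 (n : ℕ) (hn : 1 ≤ n) (α : ℂ)
    (hα : ∀ k : ℕ, (2 * k + n - α : ℂ) ≠ 0 ∧ (2 * k + n + α : ℂ) ≠ 0) :
    (∀ f ∈ spaceX n,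
      Summable (fun k : ℕ => pairing (-(Real.pi / 2)) (Real.pi / 2) (psiTerm n α k) f) ∧
      psiPairing n α (-(Real.pi / 2)) (Real.pi / 2) f =
        constC n α * pairing (-(Real.pi / 2)) (Real.pi / 2) 1 f) ∧
    (∀ f ∈ spaceY n,
      Summable (fun k : ℕ => pairing (Real.pi / 2) (3 * Real.pi / 2) (psiTerm n α k) f) ∧
      psiPairing n α (Real.pi / 2) (3 * Real.pi / 2) f =
        ((-1) ^ n * Complex.exp (-(Complex.I * α * Real.pi)) * constC n α) *
          pairing (Real.pi / 2) (3 * Real.pi / 2) 1 f) := by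
  obtain ⟨m, rfl⟩ : ∃ m, n = m + 1 := ⟨n - 1, by omega⟩
  have hpi := Real.pi_pos
  have hs : ∀ k : ℕ, (2 * k + (m + 1 - α) : ℂ) ≠ 0 := fun k => by
    have := (hα k).1
    push_cast at this
    rwa [add_sub_assoc] at this
  have hs' : ∀ k : ℕ, (2 * k + (m + 1 + α) : ℂ) ≠ 0 := fun k => by
    have := (hα k).2
    push_cast at this
    rwa [add_assoc] at this
  have hlen : Real.pi / 2 - -(Real.pi / 2) = Real.pi := by ring
  constructor
  · intro f hf
    obtain ⟨h, hg⟩ := PsiSeries.exists_isIterPrimitive_of_isTestFunction (by linarith) hf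
    exact ⟨PsiSeries.summable_pairing_psiTerm hlen hg hs hs',
      PsiSeries.psiPairing_eq_constC_mul hg hs hs'⟩
  · intro f hf
    obtain ⟨h, hg⟩ := PsiSeries.exists_isIterPrimitive_of_isTestFunction (by linarith) hf
    have hg' := hg.comp_add_right Real.pi
    rw [show Real.pi / 2 - Real.pi = -(Real.pi / 2) by ring,
      show 3 * Real.pi / 2 - Real.pi = Real.pi / 2 by ring] at hg'
    have hone := PsiSeries.pairing_comp_add_pi 1 f
    constructor
    · simp_rw [PsiSeries.pairing_psiTerm_eq_shift]
      exact (PsiSeries.summable_pairing_psiTerm hlen hg' hs hs').mul_left _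
    · have hX := PsiSeries.psiPairing_eq_constC_mul hg' hs hs'
      rw [psiPairing] at hX ⊢
      simp_rw [PsiSeries.pairing_psiTerm_eq_shift]
      rw [tsum_mul_left, hX, mul_assoc _ (constC _ _), ← hone]
      rfl
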